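/- For integers $1\le k\le n$ let $\Theta_k^{\uparrow}\subset\mathbb{R}^n$ be the set of all nondecreasing vectors with at most $k$ constant pieces, i.e. of all $\theta\in\mathbb{R}^n$ for which there are integers $0=a_0\le a_1\le\cdots\le a_k=n$ and reals $\mu_1\le\cdots\le\mu_k$ with $\theta_i=\mu_j$ whenever $a_{j-1}<i\le a_j$. For $X\in\mathbb{R}^n$ let $\hat\theta(\Theta_n^{\uparrow})=\operatorname{argmin}_{\theta_1\le\cdots\le\theta_n}\sum_{i=1}^n (X_i-\theta_i)^2$ be the ordinary isotonic regression estimator (the minimizer exists and is unique), and write $\|v\|_p=(\sum_{i=1}^n|v_i|^p)^{1/p}$. (i) Upper bound. For every $C_1>0$ and every $1\le p<2$ there is a constant $C>0$, depending only on $C_1$ and $p$, such that the following holds for all integers $1\le k\le n$ and all $\sigma>0$. If $X=\theta^*+Z$, where $Z_1,\dots,Z_n$ are independent random variables with mean zero and $\mathbb{E}|Z_i/\sigma|^2\le C_1$ for all $i$, then $$\sup_{\theta^*\in\Theta_k^{\uparrow}}\mathbb{E}\,\|\hat\theta(\Theta_n^{\uparrow})-\theta^*\|_p^p\le C\,\sigma^p\,n\,(k/n)^{p/2}.$$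 (ii) Lower bound. There is a universal constant $c>0$ such that for all $1\le p<2$, all integers $1\le k\le n$ and all $\sigma>0$, $$\inf_{\hat\theta}\ \sup_{\theta^*\in\Theta_k^{\uparrow}}\mathbb{E}\,\|\hat\theta-\theta^*\|_p^p\ge c\,\sigma^p\,n\,(k/n)^{p/2},$$ where the infimum is over all measurable functions $\hat\theta=\hat\theta(X)$ from $\mathbb{R}^n$ to $\mathbb{R}^n$ and the expectation is under $X\sim N(\theta^*,\sigma^2I_n)$. -/

import Mathlib

open MeasureTheory ProbabilityTheory
open scoped ENNReal

noncomputable section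

namespace IsoReg

/-- The set of nondecreasing vectors in `ℝⁿ` with at most `k` constant pieces: there are knots
`0 = a₀ ≤ a₁ ≤ ⋯ ≤ a_k = n` and levels `μ₁ ≤ ⋯ ≤ μ_k` such that `θ_i = μ_j` for all integers
`i ∈ (a_{j-1} : a_j]`. The coordinate with (zero-based) index `i : Fin n` is the paper's
coordinate number `i + 1`. -/
def monoPieces (n k : ℕ) : Set (Fin n → ℝ) :=
  {θ | ∃ (a : Fin (k + 1) → ℕ) (μ : Fin k → ℝ),
    a 0 = 0 ∧ a (Fin.last k) = n ∧ Monotone a ∧ Monotone μ ∧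
    ∀ (j : Fin k) (i : Fin n),
      a j.castSucc < (i : ℕ) + 1 → (i : ℕ) + 1 ≤ a j.succ → θ i = μ j}

/-- `t` is a least-squares fit to `x` in the set `S`, i.e. it minimizes `‖x - t‖²` over `S`
(Euclidean norm). -/
def IsLeastSquares {n : ℕ} (S : Set (Fin n → ℝ)) (x t : Fin n → ℝ) : Prop :=
  t ∈ S ∧ ∀ s ∈ S, ∑ i, (x i - t i) ^ 2 ≤ ∑ i, (x i - s i) ^ 2

/-- The least-squares estimator `argmin_{t ∈ S} ‖x - t‖²`. For `S = monoPieces n n`, the case that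
is used, the minimizer exists and is unique: see `existsUnique_isLeastSquares`. -/
def leastSquares {n : ℕ} (S : Set (Fin n → ℝ)) (x : Fin n → ℝ) : Fin n → ℝ :=
  Classical.epsilon (IsLeastSquares S x)

/-- The ordinary isotonic regression estimator. -/
def isotonicRegression {n : ℕ} (x : Fin n → ℝ) : Fin n → ℝ :=
  leastSquares (monoPieces n n) x

/-- The `ℓ_p` norm `(∑ |v_i|^p)^{1/p}` on `ℝⁿ`. -/
def lpNorm {n : ℕ} (p : ℝ) (v : Fin n → ℝ) : ℝ :=
  (∑ i, |v i| ^ p) ^ (1 / p)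

/-- The Gaussian law `N(θ, σ² I_n)` on `ℝⁿ`. -/
def gaussianVec {n : ℕ} (θ : Fin n → ℝ) (σ : ℝ) : Measure (Fin n → ℝ) :=
  Measure.pi fun i => gaussianReal (θ i) (Real.toNNReal (σ ^ 2))

/-- The set `monoPieces n n` consists of all the nondecreasing vectors. -/
theorem mem_monoPieces_self_iff {n : ℕ} (θ : Fin n → ℝ) :
    θ ∈ monoPieces n n ↔ Monotone θ := by
  constructor
  · rintro ⟨a, μ, h0, hn, ha, hμ, h⟩
    have key : ∀ i : Fin n, ∃ j : Fin n, a j.castSucc < (i : ℕ) + 1 ∧ (i : ℕ) + 1 ≤ a j.succ := by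
      intro i
      by_contra hcon
      push Not at hcon
      have : ∀ j : Fin (n + 1), a j < (i : ℕ) + 1 := by
        intro j
        induction j using Fin.induction with
        | zero => omega
        | succ j ih => exact hcon j ih
      have := this (Fin.last n)
      have := i.2
      omega
    intro i i' hii
    obtain ⟨j, h1, h2⟩ := key i
    obtain ⟨j', h1', h2'⟩ := key i'
    rw [h j i h1 h2, h j' i' h1' h2']
    rcases le_or_gt j j' with hj | hj
    · exact hμ hj
    · have hle : a j'.succ ≤ a j.castSucc := ha (by
        rw [Fin.le_def]; simpa using hj)
      have : (i : ℕ) ≤ i' := hii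
      omega
  · intro hθ
    refine ⟨fun j => j, θ, rfl, by simp, fun _ _ h => h, hθ, ?_⟩
    intro j i h1 h2
    have : i = j := by
      ext
      simp at h1 h2
      omega
    rw [this]

/-- Isotonic regression is well defined. -/
theorem existsUnique_isLeastSquares {n : ℕ} (x : Fin n → ℝ) :
    ∃! t, IsLeastSquares (monoPieces n n) x t := by
  have hne : (monoPieces n n).Nonempty :=
    ⟨0, (mem_monoPieces_self_iff _).2 fun _ _ _ => le_rfl⟩
  have hcl : IsClosed {θ : EuclideanSpace ℝ (Fin n) | ∀ i j : Fin n, i ≤ j → θ i ≤ θ j} := by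
    simp only [Set.setOf_forall]
    exact isClosed_iInter fun i => isClosed_iInter fun j => isClosed_iInter fun _ =>
      isClosed_le (by fun_prop) (by fun_prop)
  obtain ⟨y, hy, hmin⟩ := hcl.exists_infDist_eq_dist
    ⟨0, fun i j _ => le_rfl⟩ (WithLp.toLp 2 x)
  refine ⟨fun i => y i, ⟨(mem_monoPieces_self_iff _).2 fun i j h => hy i j h, ?_⟩, ?_⟩
  · intro s hs
    have h1 := Metric.infDist_le_dist_of_mem (x := WithLp.toLp 2 x)
      (show (WithLp.toLp 2 s : EuclideanSpace ℝ (Fin n)) ∈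
        {θ : EuclideanSpace ℝ (Fin n) | ∀ i j : Fin n, i ≤ j → θ i ≤ θ j} from
        fun i j h => (mem_monoPieces_self_iff s).1 hs h)
    rw [hmin, EuclideanSpace.dist_eq, EuclideanSpace.dist_eq] at h1
    have h2 := (Real.sqrt_le_sqrt_iff (Finset.sum_nonneg fun i _ => sq_nonneg _)).1 h1
    simpa [Real.dist_eq, sq_abs] using h2
  · intro t ht
    have hy' : Monotone fun i => y i := fun i j h => hy i j h
    have ht' := (mem_monoPieces_self_iff t).1 ht.1
    have e1 := ht.2 (fun i => y i) ((mem_monoPieces_self_iff _).2 hy')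
    have e2 := ht.2 (fun i => (t i + y i) / 2) ((mem_monoPieces_self_iff _).2
      fun i j h => by
        have := hy' h
        have := ht' h
        simp only at *
        linarith)
    have e3 : ∑ i, (x i - y i) ^ 2 ≤ ∑ i, (x i - t i) ^ 2 := by
      have h1 := Metric.infDist_le_dist_of_mem (x := WithLp.toLp 2 x)
        (show (WithLp.toLp 2 t : EuclideanSpace ℝ (Fin n)) ∈
          {θ : EuclideanSpace ℝ (Fin n) | ∀ i j : Fin n, i ≤ j → θ i ≤ θ j} from
          fun i j h => ht' h)
      rw [hmin, EuclideanSpace.dist_eq, EuclideanSpace.dist_eq] at h1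
      have h2 := (Real.sqrt_le_sqrt_iff (Finset.sum_nonneg fun i _ => sq_nonneg _)).1 h1
      simpa [Real.dist_eq, sq_abs] using h2
    have id : ∑ i, (t i - y i) ^ 2 = 2 * ∑ i, (x i - t i) ^ 2 + 2 * ∑ i, (x i - y i) ^ 2
        - 4 * ∑ i, (x i - (t i + y i) / 2) ^ 2 := by
      simp only [Finset.mul_sum, ← Finset.sum_add_distrib, ← Finset.sum_sub_distrib]
      exact Finset.sum_congr rfl fun i _ => by ring
    have hz : ∑ i, (t i - y i) ^ 2 = 0 :=
      le_antisymm (by linarith) (Finset.sum_nonneg fun i _ => sq_nonneg _)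
    funext i
    have := (Finset.sum_eq_zero_iff_of_nonneg (fun i _ => sq_nonneg (t i - y i))).1 hz i
      (Finset.mem_univ i)
    have := pow_eq_zero_iff (two_ne_zero) |>.1 this
    linarith

/-- The defining property of the isotonic regression estimator. -/
theorem isotonicRegression_spec {n : ℕ} (x : Fin n → ℝ) :
    IsLeastSquares (monoPieces n n) x (isotonicRegression x) :=
  Classical.epsilon_spec (existsUnique_isLeastSquares x).exists

end IsoReg

end

open scoped Topology

namespace IsoReg


/-! Upper bound. Lowering the fit on a window that starts where the level set of `i` starts is an
admissible direction, so the first-order condition says that the data average over some window `[s,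
b]` with `s ≤ i` is at least the fitted value at `i`. If `b` is the right end of the constant piece
of the signal containing `i`, monotonicity of the signal bounds a positive error at `i` by the noise
average over a window containing `[i, b]`. Negative errors are treated symmetrically, with windows
starting at the left end of the piece.

A Hájek–Rényi type maximal inequality (`exists_majorant_averages`) bounds the second moment of the
largest such average over windows of length at least `v` by a multiple of `C₁ σ² / v`. Truncation
then gives a `p`-th moment of order `σ ^ p * v ^ (-(p / 2))` (`exists_majorant_error`). Because `p /
2 < 1`, these terms add up over a piece of length `m` to order `m ^ (1 - p / 2)`, without a
logarithm, and concavity over `k` pieces of total length `n` gives `k * (n / k) ^ (1 - p / 2) = n *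
(k / n) ^ (p / 2)`.

Lower bound. Assouad's method: `k` balanced blocks carry levels `(j + τ j) * d` with free bits `τ
j`. The step `d` is of order `σ * √(k / n)`, so flipping one bit moves the mean by at most `σ` in
Euclidean norm and cannot be detected reliably (`gaussianVec_two_point`). Each coordinate therefore
costs about `d ^ p` on average over the cube (`hypercube_average`). -/

/-! ### Likelihood ratios and the Gaussian two-point bound. -/

/-- A two-point lower bound under a bound on the second moment of the likelihood ratio. -/
theorem two_point_lower_bound {α : Type*} [MeasurableSpace α] (P Q : Measure α)
    [IsProbabilityMeasure Q] {L : α → ℝ≥0∞} (hL : Measurable L)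
    (hQ : Q = P.withDensity L) (hL2 : ∫⁻ x, L x ^ 2 ∂P ≤ 3) {f g : α → ℝ≥0∞} (hf : Measurable f)
    (hg : Measurable g) (s : ℝ≥0∞) (hs : ∀ x, s ≤ f x + g x) :
    s / 4 ≤ ∫⁻ x, f x ∂P + ∫⁻ x, g x ∂Q := by
  -- For `L ≥ 1` this is `(L - 2) ^ 2 ≥ 0`. It turns the second-moment bound into a lower bound `1 /
  -- 4` on the overlap `∫ min 1 L`.
  have key : ∀ x, L x ≤ min 1 (L x) + L x ^ 2 / 4 := by
    intro x
    rcases le_total (L x) 1 with h | h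
    · rw [min_eq_right h]; exact le_self_add
    · rw [min_eq_left h]
      rcases eq_or_ne (L x) ∞ with hx | hx
      · simp [hx, ENNReal.top_div]
      · lift L x to NNReal using hx with r
        have : r ≤ 1 + r ^ 2 / 4 := by
          rw [← NNReal.coe_le_coe]
          push_cast
          nlinarith [sq_nonneg ((r : ℝ) - 2)]
        have h2 : ((r : ℝ≥0∞)) ≤ ((1 + r ^ 2 / 4 : NNReal) : ℝ≥0∞) := by exact_mod_cast this
        simpa [ENNReal.coe_div] using h2
  have h1 : (1 : ℝ≥0∞) ≤ ∫⁻ x, min 1 (L x) ∂P + 3 / 4 := by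
    calc (1 : ℝ≥0∞) = Q Set.univ := by simp
      _ = ∫⁻ x, L x ∂P := by rw [hQ, withDensity_apply _ MeasurableSet.univ]; simp
      _ ≤ ∫⁻ x, (min 1 (L x) + L x ^ 2 / 4) ∂P := lintegral_mono key
      _ = ∫⁻ x, min 1 (L x) ∂P + (∫⁻ x, L x ^ 2 ∂P) / 4 := by
        rw [lintegral_add_left (by fun_prop)]
        simp only [div_eq_mul_inv]
        rw [lintegral_mul_const _ (by fun_prop)]
      _ ≤ _ := by gcongr
  have h2 : (1 : ℝ≥0∞) / 4 ≤ ∫⁻ x, min 1 (L x) ∂P := by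
    have e : (1 : ℝ≥0∞) = 1 / 4 + 3 / 4 := by
      rw [← ENNReal.add_div]; norm_num
      rw [ENNReal.div_self (by norm_num) (by norm_num)]
    have h3 : (3 : ℝ≥0∞) / 4 ≠ ∞ := ENNReal.div_ne_top (by norm_num) (by norm_num)
    exact (ENNReal.add_le_add_iff_right h3).1 (e.symm.le.trans h1)
  calc s / 4 = s * (1 / 4) := by rw [mul_one_div]
    _ ≤ s * ∫⁻ x, min 1 (L x) ∂P := by gcongr
    _ = ∫⁻ x, s * min 1 (L x) ∂P := by rw [lintegral_const_mul _ (by fun_prop)]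
    _ ≤ ∫⁻ x, (f x + L x * g x) ∂P := by
      refine lintegral_mono fun x => ?_
      calc s * min 1 (L x) ≤ (f x + g x) * min 1 (L x) := by gcongr; exact hs x
        _ = f x * min 1 (L x) + min 1 (L x) * g x := by ring
        _ ≤ f x * 1 + L x * g x := by
          gcongr
          · exact min_le_left _ _
          · exact min_le_right _ _
        _ = _ := by rw [mul_one]
    _ = ∫⁻ x, f x ∂P + ∫⁻ x, g x ∂Q := by
      rw [lintegral_add_left hf, hQ, lintegral_withDensity_eq_lintegral_mul _ hL hg]
      rfl

/-- The density of `N(θ + h, v)` with respect to `N(θ, v)`. -/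
noncomputable def gaussianRatio (θ h v : ℝ) (x : ℝ) : ℝ≥0∞ :=
  ENNReal.ofReal (Real.exp (h * (x - θ) / v - h ^ 2 / (2 * v)))

theorem measurable_gaussianRatio (θ h v : ℝ) : Measurable (gaussianRatio θ h v) := by
  unfold gaussianRatio; fun_prop

theorem gaussianReal_shift_eq_withDensity (θ h : ℝ) {v : NNReal} (hv : v ≠ 0) :
    gaussianReal (θ + h) v = (gaussianReal θ v).withDensity (gaussianRatio θ h v) := by
  rw [gaussianReal_of_var_ne_zero _ hv, gaussianReal_of_var_ne_zero _ hv,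
    ← withDensity_mul _ (measurable_gaussianPDF _ _) (measurable_gaussianRatio _ _ _)]
  congr 1
  funext x
  have hv' : (v : ℝ) ≠ 0 := by exact_mod_cast hv
  rw [Pi.mul_apply, gaussianPDF, gaussianPDF, gaussianRatio,
    ← ENNReal.ofReal_mul (gaussianPDFReal_nonneg _ _ _)]
  congr 1
  rw [gaussianPDFReal, gaussianPDFReal, mul_assoc (√(2 * Real.pi * v))⁻¹, ← Real.exp_add]
  congr 2
  field_simp
  ring

/-- Completing the square: the squared ratio times the density of `N(θ, v)` is `exp (h ^ 2 / v)`
times the density of `N(θ + 2h, v)`. -/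
theorem lintegral_gaussianRatio_sq (θ h : ℝ) {v : NNReal} (hv : v ≠ 0) :
    ∫⁻ x, gaussianRatio θ h v x ^ 2 ∂(gaussianReal θ v) = ENNReal.ofReal (Real.exp (h ^ 2 / v)) := by
  have hv' : (v : ℝ) ≠ 0 := by exact_mod_cast hv
  rw [gaussianReal_of_var_ne_zero _ hv, lintegral_withDensity_eq_lintegral_mul _
    (measurable_gaussianPDF _ _) ((measurable_gaussianRatio _ _ _).pow_const 2)]
  have : ∀ x, (gaussianPDF θ v * fun x => gaussianRatio θ h v x ^ 2) x
      = ENNReal.ofReal (Real.exp (h ^ 2 / v)) * gaussianPDF (θ + 2 * h) v x := by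
    intro x
    rw [Pi.mul_apply, gaussianPDF, gaussianPDF, gaussianRatio,
      ← ENNReal.ofReal_pow (Real.exp_pos _).le,
      ← ENNReal.ofReal_mul (gaussianPDFReal_nonneg _ _ _), ← ENNReal.ofReal_mul (Real.exp_pos _).le]
    congr 1
    rw [gaussianPDFReal, gaussianPDFReal, mul_left_comm, mul_assoc, ← Real.exp_nat_mul,
      ← Real.exp_add, ← Real.exp_add]
    congr 2
    push_cast
    field_simp
    ring
  simp_rw [this]
  rw [lintegral_const_mul _ (measurable_gaussianPDF _ _), lintegral_gaussianPDF_eq_one _ hv, mul_one]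

theorem lintegral_pi_prod {ι : Type*} [Fintype ι] (μ : ι → Measure ℝ)
    [∀ i, IsProbabilityMeasure (μ i)] (f : ι → ℝ → ℝ≥0∞) (hf : ∀ i, Measurable (f i)) :
    ∫⁻ x, ∏ i, f i (x i) ∂(Measure.pi μ) = ∏ i, ∫⁻ y, f i y ∂(μ i) := by
  have h := iIndepFun_pi (μ := μ) (X := f) fun i => (hf i).aemeasurable
  rw [lintegral_prod_eq_prod_lintegral_of_indepFun (s := Finset.univ) _ h
    fun i => (hf i).comp (measurable_pi_apply i)]
  refine Finset.prod_congr rfl fun i _ => ?_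
  exact (measurePreserving_eval μ i).lintegral_comp (hf i)

/-- Product measures are determined by boxes, and the indicator of a box factors over coordinates.
-/
theorem pi_withDensity {ι : Type*} [Fintype ι] (μ ν : ι → Measure ℝ)
    [∀ i, IsProbabilityMeasure (μ i)] [∀ i, IsProbabilityMeasure (ν i)] (f : ι → ℝ → ℝ≥0∞)
    (hf : ∀ i, Measurable (f i)) (h : ∀ i, ν i = (μ i).withDensity (f i)) :
    Measure.pi ν = (Measure.pi μ).withDensity fun x => ∏ i, f i (x i) := by
  refine Measure.pi_eq fun s hs => ?_
  rw [withDensity_apply _ (MeasurableSet.univ_pi hs), ← lintegral_indicator (MeasurableSet.univ_pi hs)]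
  have : ∀ x : ι → ℝ, (Set.univ.pi s).indicator (fun x => ∏ i, f i (x i)) x
      = ∏ i, (s i).indicator (f i) (x i) := by
    intro x
    by_cases hx : x ∈ Set.univ.pi s
    · rw [Set.indicator_of_mem hx]
      exact Finset.prod_congr rfl fun i _ => (Set.indicator_of_mem (hx i trivial) _).symm
    · rw [Set.indicator_of_notMem hx]
      simp only [Set.mem_pi, Set.mem_univ, true_implies, not_forall] at hx
      obtain ⟨i, hi⟩ := hx
      exact (Finset.prod_eq_zero (Finset.mem_univ i) (Set.indicator_of_notMem hi _)).symm
  simp_rw [this]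
  rw [lintegral_pi_prod _ _ fun i => (hf i).indicator (hs i)]
  refine Finset.prod_congr rfl fun i _ => ?_
  rw [lintegral_indicator (hs i), h i, withDensity_apply _ (hs i)]

/-- Second moments of likelihood ratios multiply over coordinates, giving `exp (‖θ' - θ‖² / σ²) ≤ e
≤ 3`. -/
theorem gaussianVec_two_point {n : ℕ} (θ θ' : Fin n → ℝ) {σ : ℝ} (hσ : 0 < σ)
    (hd : ∑ i, (θ' i - θ i) ^ 2 ≤ σ ^ 2) {f g : (Fin n → ℝ) → ℝ≥0∞} (hf : Measurable f)
    (hg : Measurable g) (s : ℝ≥0∞) (hs : ∀ x, s ≤ f x + g x) :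
    s / 4 ≤ ∫⁻ x, f x ∂(gaussianVec θ σ) + ∫⁻ x, g x ∂(gaussianVec θ' σ) := by
  have hv : Real.toNNReal (σ ^ 2) ≠ 0 := by simpa using hσ.ne'
  have hvc : ((Real.toNNReal (σ ^ 2) : NNReal) : ℝ) = σ ^ 2 := Real.coe_toNNReal _ (sq_nonneg _)
  have : IsProbabilityMeasure (gaussianVec θ' σ) := by unfold gaussianVec; infer_instance
  have hm : ∀ i, Measurable (gaussianRatio (θ i) (θ' i - θ i) (Real.toNNReal (σ ^ 2))) :=
    fun i => measurable_gaussianRatio _ _ _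
  refine two_point_lower_bound (gaussianVec θ σ) (gaussianVec θ' σ)
    (L := fun x => ∏ i, gaussianRatio (θ i) (θ' i - θ i) (Real.toNNReal (σ ^ 2)) (x i)) ?_ ?_ ?_
    hf hg s hs
  · exact Finset.measurable_fun_prod _ fun i _ => (hm i).comp (measurable_pi_apply i)
  · refine pi_withDensity _ _ _ hm fun i => ?_
    rw [← gaussianReal_shift_eq_withDensity _ _ hv, add_sub_cancel]
  · simp_rw [← Finset.prod_pow]
    rw [gaussianVec, lintegral_pi_prod _
      (fun i y => gaussianRatio (θ i) (θ' i - θ i) (Real.toNNReal (σ ^ 2)) y ^ 2)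
      fun i => (hm i).pow_const 2]
    simp_rw [lintegral_gaussianRatio_sq _ _ hv]
    rw [← ENNReal.ofReal_prod_of_nonneg fun i _ => (Real.exp_pos _).le, ← Real.exp_sum,
      ← Finset.sum_div, hvc]
    have h1 : (∑ i, (θ' i - θ i) ^ 2) / σ ^ 2 ≤ 1 := (div_le_one (by positivity)).2 hd
    calc ENNReal.ofReal (Real.exp ((∑ i, (θ' i - θ i) ^ 2) / σ ^ 2))
        ≤ ENNReal.ofReal 3 := ENNReal.ofReal_le_ofReal
          ((Real.exp_le_exp.2 h1).trans (Real.exp_one_lt_d9.le.trans (by norm_num)))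
      _ = 3 := by simp


/-! ### The hypercube of block-constant signals and the minimax bound. -/

theorem lpNorm_rpow {n : ℕ} {p : ℝ} (hp : 0 < p) (v : Fin n → ℝ) :
    lpNorm p v ^ p = ∑ i, |v i| ^ p := by
  have h : 0 ≤ ∑ i, |v i| ^ p := Finset.sum_nonneg fun i _ => Real.rpow_nonneg (abs_nonneg _) _
  rw [lpNorm, ← Real.rpow_mul h, one_div, inv_mul_cancel₀ hp.ne', Real.rpow_one]

theorem ofReal_lpNorm_rpow {n : ℕ} {p : ℝ} (hp : 0 < p) (v : Fin n → ℝ) :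
    ENNReal.ofReal (lpNorm p v ^ p) = ∑ i, ENNReal.ofReal (|v i| ^ p) := by
  rw [lpNorm_rpow hp, ENNReal.ofReal_sum_of_nonneg fun i _ => Real.rpow_nonneg (abs_nonneg _) _]

/-- Flipping one bit. -/
def flipBit {k : ℕ} (j : Fin k) (τ : Fin k → Bool) : Fin k → Bool :=
  Function.update τ j (!τ j)

theorem flipBit_involutive {k : ℕ} (j : Fin k) : Function.Involutive (flipBit j) := by
  intro τ
  simp [flipBit]

/-- Averaging over the vertices of a hypercube. -/
theorem hypercube_average {n k : ℕ} (r : (Fin k → Bool) → Fin n → ℝ≥0∞) (b : Fin n → Fin k)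
    (s S : ℝ≥0∞) (hr : ∀ τ i, s ≤ r τ i + r (flipBit (b i) τ) i) (hS : ∀ τ, ∑ i, r τ i ≤ S) :
    n * s ≤ 2 * S := by
  have h1 : ∀ i, (2 ^ k : ℝ≥0∞) * s ≤ 2 * ∑ τ, r τ i := by
    intro i
    calc (2 ^ k : ℝ≥0∞) * s = ∑ _τ : Fin k → Bool, s := by simp
      _ ≤ ∑ τ, (r τ i + r (flipBit (b i) τ) i) := Finset.sum_le_sum fun τ _ => hr τ i
      _ = ∑ τ, r τ i + ∑ τ, r τ i := by
        rw [Finset.sum_add_distrib]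
        congr 1
        -- Flipping a bit permutes the cube, so both halves of the pair have the same total.
        exact Equiv.sum_comp (flipBit_involutive (b i)).toPerm fun τ => r τ i
      _ = _ := (two_mul _).symm
  have h2 : (2 ^ k : ℝ≥0∞) * (n * s) ≤ 2 ^ k * (2 * S) := by
    calc (2 ^ k : ℝ≥0∞) * (n * s) = ∑ _i : Fin n, (2 ^ k : ℝ≥0∞) * s := by
          simp [mul_left_comm]
      _ ≤ ∑ i, 2 * ∑ τ, r τ i := Finset.sum_le_sum fun i _ => h1 i
      _ = 2 * ∑ τ, ∑ i, r τ i := by rw [← Finset.mul_sum, Finset.sum_comm]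
      _ ≤ 2 * ∑ _τ : Fin k → Bool, S := by gcongr with τ; exact hS τ
      _ = 2 ^ k * (2 * S) := by simp [mul_left_comm]
  exact (ENNReal.mul_le_mul_iff_right (by simp) (by simp)).1 h2

/-- The index of the block of `i` in a balanced partition of `n` coordinates into `k` blocks. -/
def blockIndex {n k : ℕ} (hk : 1 ≤ k) (i : Fin n) : Fin k :=
  ⟨(i : ℕ) * k / n, Nat.div_lt_of_lt_mul (by
    have := i.2
    exact Nat.mul_lt_mul_of_pos_right this hk)⟩

/-- The block endpoints are the ceilings of `j * n / k`; they serve as knots in `cubeVertex_mem`. -/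
theorem blockIndex_eq_iff {n k : ℕ} (hk : 1 ≤ k) (i : Fin n) (j : Fin k) :
    blockIndex hk i = j ↔
      ((j : ℕ) * n + (k - 1)) / k ≤ i ∧ (i : ℕ) < (((j : ℕ) + 1) * n + (k - 1)) / k := by
  have hn : 0 < n := i.pos
  have h1 : ((j : ℕ) * n + (k - 1)) / k ≤ i ↔ (j : ℕ) * n + (k - 1) < ((i : ℕ) + 1) * k := by
    rw [← Nat.lt_add_one_iff, Nat.div_lt_iff_lt_mul hk]
  have h2 : (i : ℕ) < (((j : ℕ) + 1) * n + (k - 1)) / k ↔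
      ((i : ℕ) + 1) * k ≤ ((j : ℕ) + 1) * n + (k - 1) := by
    rw [← Nat.add_one_le_iff, Nat.le_div_iff_mul_le hk]
  rw [h1, h2, Fin.ext_iff, blockIndex, Nat.div_eq_iff hn, Nat.succ_mul, Nat.succ_mul]
  omega

/-- Rounding costs at most one coordinate, so a block has at most `n / k + 1 ≤ 2 * n / k` elements,
using `k ≤ n`. -/
theorem card_blockIndex {n k : ℕ} (hk : 1 ≤ k) (hkn : k ≤ n) (j : Fin k) :
    (Finset.univ.filter fun i : Fin n => blockIndex hk i = j).card * k ≤ 2 * n := by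
  have h1 : (Finset.univ.filter fun i : Fin n => blockIndex hk i = j).card ≤
      (Finset.Ico (((j : ℕ) * n + (k - 1)) / k) ((((j : ℕ) + 1) * n + (k - 1)) / k)).card := by
    refine Finset.card_le_card_of_injOn (fun i => (i : ℕ)) ?_ (Fin.val_injective.injOn)
    intro i hi
    have := (blockIndex_eq_iff hk i j).1 (by simpa using hi)
    simpa using this
  rw [Nat.card_Ico] at h1
  refine (Nat.mul_le_mul_right k h1).trans ?_
  rw [Nat.sub_mul]
  have h2 := Nat.div_mul_le_self (((j : ℕ) + 1) * n + (k - 1)) k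
  have h3 := Nat.lt_div_mul_add (a := (j : ℕ) * n + (k - 1)) hk
  rw [Nat.succ_mul] at h2
  rw [Nat.succ_mul]
  omega

/-- Vectors that are constant on balanced blocks, with levels `(j + τ_j) d`. -/
def cubeVertex {n k : ℕ} (hk : 1 ≤ k) (d : ℝ) (τ : Fin k → Bool) (i : Fin n) : ℝ :=
  ((blockIndex hk i : ℕ) + (if τ (blockIndex hk i) then 1 else 0)) * d

theorem cubeVertex_mem {n k : ℕ} (hk : 1 ≤ k) {d : ℝ} (hd : 0 ≤ d) (τ : Fin k → Bool) :
    (cubeVertex hk d τ : Fin n → ℝ) ∈ monoPieces n k := by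
  refine ⟨fun j => ((j : ℕ) * n + (k - 1)) / k,
    fun j => ((j : ℕ) + (if τ j then 1 else 0)) * d, ?_, ?_, ?_, ?_, ?_⟩
  · exact Nat.div_eq_of_lt (by simp; omega)
  · simp only [Fin.val_last]
    rw [Nat.mul_add_div hk, Nat.div_eq_of_lt (Nat.sub_lt hk one_pos), Nat.add_zero]
  · intro i j h
    have : (i : ℕ) ≤ j := h
    dsimp only
    gcongr
  · intro i j h
    rcases h.eq_or_lt with rfl | h
    · exact le_rfl
    -- Consecutive base levels differ by `d`, which is all that a bit can add, so monotonicity holds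
    -- for every choice of bits.
    · have h1 : (i : ℕ) + 1 ≤ j := h
      have h2 : ((i : ℕ) : ℝ) + 1 ≤ (j : ℕ) := by exact_mod_cast h1
      refine mul_le_mul_of_nonneg_right ?_ hd
      split_ifs <;> linarith
  · intro j i h1 h2
    have : blockIndex hk i = j := (blockIndex_eq_iff hk i j).2 ⟨by
      simp only [Fin.val_castSucc] at h1; omega, by simp only [Fin.val_succ] at h2; omega⟩
    simp only [cubeVertex, this]

theorem cubeVertex_flip_sub {n k : ℕ} (hk : 1 ≤ k) (d : ℝ) (τ : Fin k → Bool) (j : Fin k)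
    (i : Fin n) :
    |cubeVertex hk d (flipBit j τ) i - cubeVertex hk d τ i| =
      if blockIndex hk i = j then |d| else 0 := by
  unfold cubeVertex flipBit
  by_cases h : blockIndex hk i = j
  · subst h
    cases h : τ (blockIndex hk i) <;> simp [add_mul]
  · simp [h]

theorem sum_cubeVertex_flip_sq {n k : ℕ} (hk : 1 ≤ k) (hkn : k ≤ n) (d : ℝ) (τ : Fin k → Bool)
    (j : Fin k) :
    ∑ i : Fin n, (cubeVertex hk d (flipBit j τ) i - cubeVertex hk d τ i) ^ 2 ≤
      2 * n / k * d ^ 2 := by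
  have hk' : (0 : ℝ) < k := by exact_mod_cast hk
  have h : ((Finset.univ.filter fun i : Fin n => blockIndex hk i = j).card : ℝ) * k ≤ 2 * n := by
    exact_mod_cast card_blockIndex hk hkn j
  calc ∑ i : Fin n, (cubeVertex hk d (flipBit j τ) i - cubeVertex hk d τ i) ^ 2
      = ∑ i : Fin n, if blockIndex hk i = j then d ^ 2 else 0 := by
        refine Finset.sum_congr rfl fun i _ => ?_
        rw [← sq_abs, cubeVertex_flip_sub]
        split_ifs <;> simp
    _ = (Finset.univ.filter fun i : Fin n => blockIndex hk i = j).card * d ^ 2 := by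
        rw [← Finset.sum_filter]; simp
    _ ≤ _ := by
        gcongr
        rwa [le_div_iff₀ hk']

/-- One of the two distances is at least `|y - z| / 2`, and `2 ^ p ≤ 4`. -/
theorem abs_rpow_add_abs_rpow_ge {p : ℝ} (hp : 0 ≤ p) (hp2 : p ≤ 2) (x y z : ℝ) :
    |y - z| ^ p / 4 ≤ |x - z| ^ p + |x - y| ^ p := by
  have h1 : |y - z| ^ p / 4 ≤ (|y - z| / 2) ^ p := by
    rw [Real.div_rpow (abs_nonneg _) (by norm_num)]
    gcongr
    calc (2 : ℝ) ^ p ≤ 2 ^ (2 : ℝ) := Real.rpow_le_rpow_of_exponent_le (by norm_num) hp2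
      _ = 4 := by norm_num
  have h2 := Real.rpow_nonneg (abs_nonneg (x - z)) p
  have h3 := Real.rpow_nonneg (abs_nonneg (x - y)) p
  have h4 : |y - z| ≤ |x - z| + |x - y| := by
    rw [abs_sub_comm x y, add_comm]; exact abs_sub_le y x z
  rcases le_total (|y - z| / 2) |x - z| with h | h
  · have := Real.rpow_le_rpow (by positivity) h hp
    linarith
  · have := Real.rpow_le_rpow (by positivity) (show |y - z| / 2 ≤ |x - y| by linarith) hp
    linarith

/-- Minimax lower bound over vectors with `k` monotone pieces. -/
theorem minimax_lower_bound {p : ℝ} (hp : 1 ≤ p) (hp2 : p < 2) {n k : ℕ} (hk : 1 ≤ k)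
    (hkn : k ≤ n) {σ : ℝ} (hσ : 0 < σ) (est : (Fin n → ℝ) → (Fin n → ℝ)) (hest : Measurable est) :
    ENNReal.ofReal (1 / 64 * σ ^ p * n * ((k : ℝ) / n) ^ (p / 2)) ≤
      ⨆ θ ∈ monoPieces n k, ∫⁻ x, ENNReal.ofReal (lpNorm p (est x - θ) ^ p) ∂(gaussianVec θ σ) := by
  have hk' : (0 : ℝ) < k := by exact_mod_cast hk
  have hn' : (0 : ℝ) < n := by exact_mod_cast hk.trans hkn
  -- Chosen so that `2 * n / k * d ^ 2 = σ ^ 2`, exactly the separation allowed by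
  -- `gaussianVec_two_point`.
  set d : ℝ := σ * √(k / (2 * n)) with hd
  have hd0 : 0 < d := by positivity
  have hmeas : ∀ (θ : Fin n → ℝ) (i : Fin n),
      Measurable fun x => ENNReal.ofReal (|est x i - θ i| ^ p) := by
    intro θ i
    have h1 : Measurable fun x => est x i := (measurable_pi_apply i).comp hest
    fun_prop
  have key := hypercube_average
    (fun τ i => ∫⁻ x, ENNReal.ofReal (|est x i - cubeVertex hk d τ i| ^ p)
      ∂(gaussianVec (cubeVertex hk d τ) σ))
    (blockIndex hk) (ENNReal.ofReal (d ^ p / 4) / 4)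
    (⨆ θ ∈ monoPieces n k, ∫⁻ x, ENNReal.ofReal (lpNorm p (est x - θ) ^ p) ∂(gaussianVec θ σ))
    (fun τ i => ?_) (fun τ => ?_)
  · have h1 : d ^ p ≥ σ ^ p * ((k : ℝ) / n) ^ (p / 2) / 2 := by
      have e : d ^ p = σ ^ p * (((k : ℝ) / n) ^ (p / 2) / 2 ^ (p / 2)) := by
        rw [hd, Real.mul_rpow hσ.le (Real.sqrt_nonneg _), Real.sqrt_eq_rpow,
          ← Real.rpow_mul (by positivity), ← Real.div_rpow (by positivity) (by norm_num)]
        congr 2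
        · field_simp
        · ring
      rw [e, mul_div_assoc]
      gcongr
      calc (2 : ℝ) ^ (p / 2) ≤ 2 ^ (1 : ℝ) :=
            Real.rpow_le_rpow_of_exponent_le (by norm_num) (by linarith)
        _ = 2 := by norm_num
    rw [← ENNReal.mul_le_mul_iff_right (a := 2) (by norm_num) (by norm_num)]
    refine le_trans ?_ key
    have e4 : (4 : ℝ≥0∞) = ENNReal.ofReal 4 := by simp
    have e2 : (2 : ℝ≥0∞) = ENNReal.ofReal 2 := by simp
    rw [e4, e2, ← ENNReal.ofReal_div_of_pos (by norm_num), ← ENNReal.ofReal_natCast n,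
      ← ENNReal.ofReal_mul (by positivity), ← ENNReal.ofReal_mul (by positivity)]
    refine ENNReal.ofReal_le_ofReal ?_
    -- The constant is `64 = 2 * 2 * 4 * 4`: cube averaging, `2 ^ (p / 2) ≤ 2`, the triangle
    -- inequality and the two-point bound.
    calc 2 * (1 / 64 * σ ^ p * n * ((k : ℝ) / n) ^ (p / 2))
        = n * ((σ ^ p * ((k : ℝ) / n) ^ (p / 2) / 2) / 4 / 4) := by ring
      _ ≤ _ := by gcongr
  · refine gaussianVec_two_point _ _ hσ ?_ (hmeas _ i) (hmeas _ i) _ fun x => ?_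
    · refine (sum_cubeVertex_flip_sq hk hkn d τ _).trans (le_of_eq ?_)
      rw [hd, mul_pow, Real.sq_sqrt (by positivity)]
      field_simp
    · rw [← ENNReal.ofReal_add (by positivity) (by positivity)]
      refine ENNReal.ofReal_le_ofReal ?_
      have := abs_rpow_add_abs_rpow_ge (by linarith) hp2.le (est x i)
        (cubeVertex hk d (flipBit (blockIndex hk i) τ) i) (cubeVertex hk d τ i)
      rwa [cubeVertex_flip_sub, if_pos rfl, abs_of_pos hd0] at this
  · rw [← lintegral_finsetSum _ fun i _ => hmeas _ i]
    refine le_trans (le_of_eq ?_) (le_iSup₂ (cubeVertex hk d τ) (cubeVertex_mem hk hd0.le τ))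
    simp_rw [ofReal_lpNorm_rpow (show 0 < p by linarith)]
    rfl


/-! ### First-order conditions for isotonic regression. -/

/-- Expand the square at the feasible point `t + ε v`, divide by `ε`, and let `ε` decrease to `0`.
-/
theorem IsLeastSquares.sum_mul_nonpos {n : ℕ} {x t : Fin n → ℝ}
    (ht : IsLeastSquares (monoPieces n n) x t) (v : Fin n → ℝ)
    (hv : ∀ᶠ ε : ℝ in 𝓝[>] 0, Monotone fun j => t j + ε * v j) :
    ∑ j, (x j - t j) * v j ≤ 0 := by
  have h1 : ∀ᶠ ε : ℝ in 𝓝[>] 0, ∑ j, (x j - t j) * v j ≤ ε * ((∑ j, v j ^ 2) / 2) := by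
    filter_upwards [hv, self_mem_nhdsWithin] with ε hε hpos
    have hpos : 0 < ε := hpos
    have h := ht.2 _ ((mem_monoPieces_self_iff _).2 hε)
    have e : ∑ j, (x j - (t j + ε * v j)) ^ 2 = ∑ j, (x j - t j) ^ 2
        - ε * (2 * ∑ j, (x j - t j) * v j) + ε * (ε * ∑ j, v j ^ 2) := by
      simp only [Finset.mul_sum, ← Finset.sum_add_distrib, ← Finset.sum_sub_distrib]
      exact Finset.sum_congr rfl fun i _ => by ring
    rw [e] at h
    have h2 : ε * (2 * ∑ j, (x j - t j) * v j) ≤ ε * (ε * ∑ j, v j ^ 2) := by linarith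
    have := le_of_mul_le_mul_left h2 hpos
    linarith
  have h2 : Filter.Tendsto (fun ε : ℝ => ε * ((∑ j, v j ^ 2) / 2)) (𝓝[>] 0) (𝓝 0) := by
    have : Filter.Tendsto (fun ε : ℝ => ε * ((∑ j, v j ^ 2) / 2)) (𝓝 0)
        (𝓝 (0 * ((∑ j, v j ^ 2) / 2))) := by
      apply Continuous.tendsto; fun_prop
    rw [zero_mul] at this
    exact this.mono_left nhdsWithin_le_nhds
  exact ge_of_tendsto h2 h1

theorem eventually_forall_lt_add {n : ℕ} (t : Fin n → ℝ) (i j : Fin n) (h : t i < t j) :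
    ∀ᶠ ε : ℝ in 𝓝[>] 0, t i + ε < t j := by
  have : Filter.Tendsto (fun ε : ℝ => t i + ε) (𝓝[>] 0) (𝓝 (t i + 0)) :=
    (Continuous.tendsto (by fun_prop) 0).mono_left nhdsWithin_le_nhds
  rw [add_zero] at this
  exact this.eventually_lt_const h

/-- Take `s` to be the first index of the level set of `i`. The strict jump before `s` leaves room
to lower `t` on `[s, b]`, and `t j ≥ t i` there. This is one half of the min-max description of the
fit. -/
theorem IsLeastSquares.exists_sum_Icc_nonneg {n : ℕ} {x t : Fin n → ℝ}
    (ht : IsLeastSquares (monoPieces n n) x t) (i b : Fin n) :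
    ∃ s ≤ i, 0 ≤ ∑ j ∈ Finset.Icc s b, (x j - t i) := by
  have hmono := (mem_monoPieces_self_iff t).1 ht.1
  have hne : (Finset.univ.filter fun j => t j = t i).Nonempty := ⟨i, by simp⟩
  obtain ⟨s, hs, hmin⟩ : ∃ s, t s = t i ∧ ∀ j, t j = t i → s ≤ j :=
    ⟨_, (Finset.mem_filter.1 (Finset.min'_mem _ hne)).2,
      fun j hj => Finset.min'_le _ _ (by simpa using hj)⟩
  refine ⟨s, hmin i rfl, ?_⟩
  have hv : ∑ j, (x j - t j) * (if j ∈ Finset.Icc s b then (-1 : ℝ) else 0) ≤ 0 := by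
    refine ht.sum_mul_nonpos _ ?_
    have hev : ∀ᶠ ε : ℝ in 𝓝[>] 0, ∀ j, j < s → t j + ε < t s := by
      refine Filter.eventually_all.2 fun j => ?_
      by_cases hj : j < s
      · have hlt : t j < t s := lt_of_le_of_ne (hmono hj.le) fun h =>
          absurd (hmin j (h.trans hs)) (not_le.2 hj)
        filter_upwards [eventually_forall_lt_add t j s hlt] with ε h _ using h
      · exact Filter.Eventually.of_forall fun _ h => absurd h hj
    filter_upwards [hev, self_mem_nhdsWithin] with ε hε hpos
    have hpos : 0 < ε := hpos
    intro j j' hjj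
    have h1 := hmono hjj
    dsimp only
    by_cases hj' : j' ∈ Finset.Icc s b
    · by_cases hj : j ∈ Finset.Icc s b
      · rw [if_pos hj, if_pos hj']; linarith
      · have hjs : j < s := by
          by_contra hcon
          exact hj (Finset.mem_Icc.2 ⟨not_lt.1 hcon, hjj.trans (Finset.mem_Icc.1 hj').2⟩)
        rw [if_neg hj, if_pos hj']
        have := hε j hjs
        have := hmono (Finset.mem_Icc.1 hj').1
        linarith
    · rw [if_neg hj']
      split_ifs <;> linarith
  have h2 : 0 ≤ ∑ j ∈ Finset.Icc s b, (x j - t j) := by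
    simp only [mul_ite, mul_neg, mul_one, mul_zero, Finset.sum_ite_mem, Finset.univ_inter,
      Finset.sum_neg_distrib] at hv
    linarith
  refine h2.trans (Finset.sum_le_sum fun j hj => ?_)
  have := hmono (Finset.mem_Icc.1 hj).1
  linarith

/-- The mirror image: raise `t` up to the last index of the level set of `i`. -/
theorem IsLeastSquares.exists_sum_Icc_nonpos {n : ℕ} {x t : Fin n → ℝ}
    (ht : IsLeastSquares (monoPieces n n) x t) (a i : Fin n) :
    ∃ s, i ≤ s ∧ ∑ j ∈ Finset.Icc a s, (x j - t i) ≤ 0 := by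
  have hmono := (mem_monoPieces_self_iff t).1 ht.1
  have hne : (Finset.univ.filter fun j => t j = t i).Nonempty := ⟨i, by simp⟩
  obtain ⟨s, hs, hmax⟩ : ∃ s, t s = t i ∧ ∀ j, t j = t i → j ≤ s :=
    ⟨_, (Finset.mem_filter.1 (Finset.max'_mem _ hne)).2,
      fun j hj => Finset.le_max' _ _ (by simpa using hj)⟩
  refine ⟨s, hmax i rfl, ?_⟩
  have hv : ∑ j, (x j - t j) * (if j ∈ Finset.Icc a s then (1 : ℝ) else 0) ≤ 0 := by
    refine ht.sum_mul_nonpos _ ?_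
    have hev : ∀ᶠ ε : ℝ in 𝓝[>] 0, ∀ j, s < j → t s + ε < t j := by
      refine Filter.eventually_all.2 fun j => ?_
      by_cases hj : s < j
      · have hlt : t s < t j := lt_of_le_of_ne (hmono hj.le) fun h =>
          absurd (hmax j (h.symm.trans hs)) (not_le.2 hj)
        filter_upwards [eventually_forall_lt_add t s j hlt] with ε h _ using h
      · exact Filter.Eventually.of_forall fun _ h => absurd h hj
    filter_upwards [hev, self_mem_nhdsWithin] with ε hε hpos
    have hpos : 0 < ε := hpos
    intro j j' hjj
    have h1 := hmono hjj
    dsimp only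
    by_cases hj : j ∈ Finset.Icc a s
    · by_cases hj' : j' ∈ Finset.Icc a s
      · rw [if_pos hj, if_pos hj']; linarith
      · have hjs : s < j' := by
          by_contra hcon
          exact hj' (Finset.mem_Icc.2 ⟨(Finset.mem_Icc.1 hj).1.trans hjj, not_lt.1 hcon⟩)
        rw [if_pos hj, if_neg hj']
        have := hε j' hjs
        have := hmono (Finset.mem_Icc.1 hj).2
        linarith
    · rw [if_neg hj]
      split_ifs <;> linarith
  have h2 : ∑ j ∈ Finset.Icc a s, (x j - t j) ≤ 0 := by
    simpa only [mul_ite, mul_one, mul_zero, Finset.sum_ite_mem, Finset.univ_inter] using hv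
  refine le_trans (Finset.sum_le_sum fun j hj => ?_) h2
  have := hmono (Finset.mem_Icc.1 hj).2
  linarith

/-- One-sided control of the error of isotonic regression by averages of the noise. -/
theorem exists_card_mul_error_le {n : ℕ} {θ : Fin n → ℝ} (hθ : Monotone θ) (z : Fin n → ℝ)
    {i b : Fin n} (hb : θ b = θ i) :
    ∃ s ≤ i, ((b : ℕ) + 1 - s : ℕ) * (isotonicRegression (fun j => θ j + z j) i - θ i) ≤
      ∑ j ∈ Finset.Icc s b, z j := by
  obtain ⟨s, hs, h⟩ := (isotonicRegression_spec fun j => θ j + z j).exists_sum_Icc_nonneg i b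
  refine ⟨s, hs, ?_⟩
  rw [← Fin.card_Icc, ← nsmul_eq_mul, ← Finset.sum_const, ← sub_nonneg, ← Finset.sum_sub_distrib]
  -- For `j ≤ b` the signal satisfies `θ j ≤ θ b = θ i`, so replacing it by `θ i` only increases the
  -- sum.
  refine h.trans (Finset.sum_le_sum fun j hj => ?_)
  have := hθ (Finset.mem_Icc.1 hj).2
  linarith

theorem exists_le_card_mul_error {n : ℕ} {θ : Fin n → ℝ} (hθ : Monotone θ) (z : Fin n → ℝ)
    {a i : Fin n} (ha : θ a = θ i) :
    ∃ s, i ≤ s ∧ ∑ j ∈ Finset.Icc a s, z j ≤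
      ((s : ℕ) + 1 - a : ℕ) * (isotonicRegression (fun j => θ j + z j) i - θ i) := by
  obtain ⟨s, hs, h⟩ := (isotonicRegression_spec fun j => θ j + z j).exists_sum_Icc_nonpos a i
  refine ⟨s, hs, ?_⟩
  rw [← Fin.card_Icc, ← nsmul_eq_mul, ← Finset.sum_const, ← sub_nonpos, ← Finset.sum_sub_distrib]
  refine le_trans (Finset.sum_le_sum fun j hj => ?_) h
  have := hθ (Finset.mem_Icc.1 hj).1
  linarith


/-! ### Maximal inequalities for sums and averages of the noise. -/

/-- The running maximum of the positive part of a sequence that starts at `0`. -/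
def runMax (T : ℕ → ℝ) : ℕ → ℝ
  | 0 => 0
  | l + 1 => max (runMax T l) (T (l + 1))

theorem runMax_mono (T : ℕ → ℝ) : Monotone (runMax T) :=
  monotone_nat_of_le_succ fun _ => le_max_left _ _

theorem runMax_nonneg (T : ℕ → ℝ) (l : ℕ) : 0 ≤ runMax T l :=
  runMax_mono T (Nat.zero_le l)

theorem le_runMax {T : ℕ → ℝ} (hT : T 0 = 0) {j l : ℕ} (h : j ≤ l) : T j ≤ runMax T l := by
  refine le_trans ?_ (runMax_mono T h)
  cases j with
  | zero => exact hT.le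
  | succ j => exact le_max_right _ _

/-- The pathwise form of Doob's `L²` maximal inequality. -/
theorem runMax_sq_le (T : ℕ → ℝ) (N : ℕ) :
    runMax T N ^ 2 ≤ 4 * T N ^ 2 - 4 * ∑ k ∈ Finset.range N, runMax T k * (T (k + 1) - T k) := by
  -- A discrete integration by parts, proved by induction; `2 M T ≤ M ^ 2 / 2 + 2 T ^ 2` then
  -- absorbs the cross term.
  have h : runMax T N ^ 2 + 2 * ∑ k ∈ Finset.range N, runMax T k * (T (k + 1) - T k) ≤
      2 * runMax T N * T N := by
    induction N with
    | zero => simp [runMax]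
    | succ N ih =>
      rw [Finset.sum_range_succ]
      rcases le_total (runMax T N) (T (N + 1)) with h | h
      · have e : runMax T (N + 1) = T (N + 1) := max_eq_right h
        rw [e]
        nlinarith [sq_nonneg (T (N + 1) - runMax T N)]
      · have e : runMax T (N + 1) = runMax T N := max_eq_left h
        rw [e]
        linarith
  nlinarith [sq_nonneg (runMax T N - 2 * T N)]

/-- A summation by parts: averages are controlled by the maximum of weighted sums. -/
theorem abs_sum_le_of_weighted (z : ℕ → ℝ) {v l : ℕ} (hv : 1 ≤ v) (hvl : v ≤ l) {M : ℝ}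
    (hM : ∀ j ≤ l, |∑ m ∈ Finset.range j, (1 / (max (m + 1) v : ℕ) : ℝ) * z m| ≤ M) :
    |∑ m ∈ Finset.range l, z m| ≤ l * (2 * M) := by
  set T : ℕ → ℝ := fun j => ∑ m ∈ Finset.range j, (1 / (max (m + 1) v : ℕ) : ℝ) * z m with hT
  -- Abel summation: the discrepancy accumulates the increments of `max j v` against weighted sums
  -- bounded by `M`.
  have key : ∀ j ≤ l, |∑ m ∈ Finset.range j, z m - (max j v : ℕ) * T j| ≤
      ((max j v : ℕ) - v) * M := by
    intro j
    induction j with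
    | zero => intro _; simp [hT]
    | succ j ih =>
      intro hj
      have h1 := ih (by omega)
      have h2 := hM j (by omega)
      have hc : (0 : ℝ) < (max (j + 1) v : ℕ) := by
        have : 0 < max (j + 1) v := by omega
        exact_mod_cast this
      have hcc : ((max j v : ℕ) : ℝ) ≤ (max (j + 1) v : ℕ) := by
        exact_mod_cast max_le_max_right v (Nat.le_succ j)
      have e : ∑ m ∈ Finset.range (j + 1), z m - (max (j + 1) v : ℕ) * T (j + 1) =
          (∑ m ∈ Finset.range j, z m - (max j v : ℕ) * T j) -
            ((max (j + 1) v : ℕ) - (max j v : ℕ)) * T j := by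
        simp only [hT, Finset.sum_range_succ]
        field_simp
        ring
      rw [e]
      calc _ ≤ |∑ m ∈ Finset.range j, z m - (max j v : ℕ) * T j| +
            |(((max (j + 1) v : ℕ) : ℝ) - (max j v : ℕ)) * T j| := abs_sub _ _
        _ ≤ ((max j v : ℕ) - v) * M + ((max (j + 1) v : ℕ) - (max j v : ℕ)) * M := by
          refine add_le_add h1 ?_
          rw [abs_mul, abs_of_nonneg (sub_nonneg.2 hcc)]
          exact mul_le_mul_of_nonneg_left h2 (sub_nonneg.2 hcc)
        _ = _ := by ring
  have h1 := key l le_rfl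
  have h2 := hM l le_rfl
  rw [max_eq_left hvl] at h1
  have hM0 : 0 ≤ M := (abs_nonneg _).trans h2
  calc |∑ m ∈ Finset.range l, z m|
      = |(∑ m ∈ Finset.range l, z m - (l : ℕ) * T l) + l * T l| := by rw [sub_add_cancel]
    _ ≤ (l - v) * M + l * M := by
      refine (abs_add_le _ _).trans (add_le_add h1 ?_)
      rw [abs_mul, Nat.abs_cast]
      exact mul_le_mul_of_nonneg_left h2 (Nat.cast_nonneg _)
    _ ≤ _ := by nlinarith [mul_nonneg (Nat.cast_nonneg (α := ℝ) v) hM0]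

/-- The first `v` weights contribute `1 / v`, and the tail of `1 / m ^ 2` telescopes to at most
another `1 / v`. -/
theorem sum_weights_sq_le {v : ℕ} (hv : 1 ≤ v) (N : ℕ) :
    ∑ m ∈ Finset.range N, (1 / (max (m + 1) v : ℕ) : ℝ) ^ 2 ≤ 2 / v := by
  have hv' : (0 : ℝ) < v := by exact_mod_cast hv
  have h1 : ∀ N ≤ v, ∑ m ∈ Finset.range N, (1 / (max (m + 1) v : ℕ) : ℝ) ^ 2 = N / v ^ 2 := by
    intro N hN
    rw [Finset.sum_congr rfl (g := fun _ => 1 / (v : ℝ) ^ 2)]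
    · simp [div_eq_mul_inv]
    · intro m hm
      rw [max_eq_right (by have := Finset.mem_range.1 hm; omega), div_pow, one_pow]
  have h2 : ∀ N, v ≤ N →
      ∑ m ∈ Finset.range N, (1 / (max (m + 1) v : ℕ) : ℝ) ^ 2 ≤ 2 / v - 1 / N := by
    intro N hN
    induction N, hN using Nat.le_induction with
    | base =>
      rw [h1 v le_rfl]
      refine le_of_eq ?_
      field_simp
      norm_num
    | succ N hN ih =>
      rw [Finset.sum_range_succ, max_eq_left (by omega)]
      have hN' : (0 : ℝ) < N := by exact_mod_cast hv.trans hN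
      have : (1 / ((N + 1 : ℕ) : ℝ)) ^ 2 ≤ 1 / N - 1 / (N + 1 : ℕ) := by
        push_cast
        rw [div_sub_div _ _ (by positivity) (by positivity), div_pow, div_le_div_iff₀
          (by positivity) (by positivity)]
        nlinarith
      linarith
  rcases le_total N v with h | h
  · rw [h1 N h, div_le_div_iff₀ (by positivity) hv']
    have : (N : ℝ) ≤ v := by exact_mod_cast h
    nlinarith
  · refine (h2 N h).trans ?_
    have : (0 : ℝ) ≤ 1 / N := by positivity
    linarith

section Noise

variable {Ω ι : Type*} {Z : ι → Ω → ℝ}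

/-- The sigma-algebra generated by the first `k` terms of a sequence of noise variables. -/
@[reducible]
def pastSigma (Z : ι → Ω → ℝ) (e : ℕ → ι) (k : ℕ) : MeasurableSpace Ω :=
  ⨆ i ∈ e '' Set.Iio k, MeasurableSpace.comap (Z i) inferInstance

theorem measurable_pastSigma {e : ℕ → ι} {j k : ℕ} (h : j < k) :
    Measurable[pastSigma Z e k] (Z (e j)) := by
  refine Measurable.mono (comap_measurable (Z (e j))) ?_ le_rfl
  exact le_biSup (fun i => MeasurableSpace.comap (Z i) inferInstance) ⟨j, h, rfl⟩

/-- Weighted partial sums of the noise. -/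
def weightedSum (Z : ι → Ω → ℝ) (e : ℕ → ι) (w : ℕ → ℝ) (l : ℕ) (ω : Ω) : ℝ :=
  ∑ j ∈ Finset.range l, w j * Z (e j) ω

theorem weightedSum_succ (e : ℕ → ι) (w : ℕ → ℝ) (l : ℕ) (ω : Ω) :
    weightedSum Z e w (l + 1) ω = weightedSum Z e w l ω + w l * Z (e l) ω :=
  Finset.sum_range_succ _ _

theorem measurable_weightedSum_of (m : MeasurableSpace Ω) (e : ℕ → ι) (w : ℕ → ℝ) (l : ℕ)
    (h : ∀ j < l, Measurable[m] (Z (e j))) : Measurable[m] (weightedSum Z e w l) := by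
  unfold weightedSum
  exact Finset.measurable_fun_sum _ fun j hj => (h j (Finset.mem_range.1 hj)).const_mul _

theorem measurable_runMax_of (m : MeasurableSpace Ω) (e : ℕ → ι) (w : ℕ → ℝ) (l : ℕ)
    (h : ∀ j < l, Measurable[m] (Z (e j))) :
    Measurable[m] fun ω => runMax (fun j => weightedSum Z e w j ω) l := by
  induction l with
  | zero => exact measurable_const
  | succ l ih =>
    exact (ih fun j hj => h j (by omega)).max (measurable_weightedSum_of m e w (l + 1) h)

variable [MeasurableSpace Ω] {P : Measure Ω}

/-- Injectivity of `e` keeps the index `e k` out of the past indices, so disjoint blocks of an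
independent family apply. -/
theorem indepFun_of_pastSigma (hm : ∀ i, Measurable (Z i)) (hZ : iIndepFun Z P) {e : ℕ → ι}
    {N k : ℕ} (he : Set.InjOn e (Set.Iio N)) (hk : k < N) {g : Ω → ℝ}
    (hg : Measurable[pastSigma Z e k] g) : IndepFun g (Z (e k)) P := by
  have hdisj : Disjoint (e '' Set.Iio k) {e k} := by
    rw [Set.disjoint_singleton_right]
    rintro ⟨j, hj, hjk⟩
    have hj' : j < k := hj
    have := he (show j < N by omega) hk hjk
    omega
  have h := indep_iSup_of_disjoint (fun i => (hm i).comap_le) hZ hdisj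
  rw [IndepFun_iff_Indep]
  refine indep_of_indep_of_le_left (indep_of_indep_of_le_right h ?_) hg.comap_le
  simp

theorem integral_mul_eq_zero_of_pastSigma [IsProbabilityMeasure P] (hm : ∀ i, Measurable (Z i))
    (hZ : iIndepFun Z P) (hmean : ∀ i, ∫ ω, Z i ω ∂P = 0) {e : ℕ → ι}
    {N k : ℕ} (he : Set.InjOn e (Set.Iio N)) (hk : k < N) {g : Ω → ℝ}
    (hg : Measurable[pastSigma Z e k] g) (hg' : Measurable g) : ∫ ω, g ω * Z (e k) ω ∂P = 0 := by
  rw [(indepFun_of_pastSigma hm hZ he hk hg).integral_fun_mul_eq_mul_integral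
    hg'.aestronglyMeasurable (hm _).aestronglyMeasurable, hmean, mul_zero]

theorem memLp_weightedSum (hL : ∀ i, MemLp (Z i) 2 P) (e : ℕ → ι) (w : ℕ → ℝ) (l : ℕ) :
    MemLp (weightedSum Z e w l) 2 P := by
  unfold weightedSum
  exact memLp_finsetSum _ fun j _ => (hL (e j)).const_mul _

theorem memLp_runMax [IsProbabilityMeasure P] (hL : ∀ i, MemLp (Z i) 2 P) (e : ℕ → ι)
    (w : ℕ → ℝ) (l : ℕ) : MemLp (fun ω => runMax (fun j => weightedSum Z e w j ω) l) 2 P := by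
  induction l with
  | zero => exact memLp_const 0
  | succ l ih => exact ih.sup (memLp_weightedSum hL e w (l + 1))

theorem integral_weightedSum_sq_le [IsProbabilityMeasure P] (hm : ∀ i, Measurable (Z i))
    (hZ : iIndepFun Z P) (hL : ∀ i, MemLp (Z i) 2 P) (hmean : ∀ i, ∫ ω, Z i ω ∂P = 0) {V : ℝ}
    (hV : ∀ i, ∫ ω, Z i ω ^ 2 ∂P ≤ V) {e : ℕ → ι} {N : ℕ} (he : Set.InjOn e (Set.Iio N))
    (w : ℕ → ℝ) {l : ℕ} (hl : l ≤ N) :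
    ∫ ω, weightedSum Z e w l ω ^ 2 ∂P ≤ V * ∑ j ∈ Finset.range l, w j ^ 2 := by
  induction l with
  | zero => simp [weightedSum]
  | succ l ih =>
    have hT := memLp_weightedSum hL e w l
    have h0 : ∫ ω, weightedSum Z e w l ω * Z (e l) ω ∂P = 0 :=
      integral_mul_eq_zero_of_pastSigma hm hZ hmean he hl
        (measurable_weightedSum_of _ e w l fun j hj => measurable_pastSigma hj)
        (measurable_weightedSum_of _ e w l fun j _ => hm _)
    have i1 : Integrable (fun ω => weightedSum Z e w l ω * Z (e l) ω) P :=
      hT.integrable_mul (hL (e l))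
    have e1 : ∀ ω, weightedSum Z e w (l + 1) ω ^ 2 = weightedSum Z e w l ω ^ 2 +
        2 * w l * (weightedSum Z e w l ω * Z (e l) ω) + w l ^ 2 * Z (e l) ω ^ 2 := by
      intro ω
      rw [weightedSum_succ]
      ring
    simp_rw [e1]
    rw [integral_add (f := fun ω => weightedSum Z e w l ω ^ 2 +
        2 * w l * (weightedSum Z e w l ω * Z (e l) ω)) (hT.integrable_sq.add (i1.const_mul _)) ((hL (e l)).integrable_sq.const_mul _),
      integral_add hT.integrable_sq (i1.const_mul _), integral_const_mul, integral_const_mul, h0,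
      Finset.sum_range_succ]
    nlinarith [ih (by omega), mul_le_mul_of_nonneg_left (hV (e l)) (sq_nonneg (w l))]

/-- Doob's `L²` maximal inequality for weighted sums of independent centred variables. -/
theorem integral_runMax_sq_le [IsProbabilityMeasure P] (hm : ∀ i, Measurable (Z i))
    (hZ : iIndepFun Z P) (hL : ∀ i, MemLp (Z i) 2 P) (hmean : ∀ i, ∫ ω, Z i ω ∂P = 0) {V : ℝ}
    (hV : ∀ i, ∫ ω, Z i ω ^ 2 ∂P ≤ V) {e : ℕ → ι} {N : ℕ} (he : Set.InjOn e (Set.Iio N))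
    (w : ℕ → ℝ) :
    ∫ ω, runMax (fun j => weightedSum Z e w j ω) N ^ 2 ∂P ≤
      4 * (V * ∑ j ∈ Finset.range N, w j ^ 2) := by
  have hi : ∀ k, Integrable (fun ω => runMax (fun j => weightedSum Z e w j ω) k *
      (weightedSum Z e w (k + 1) ω - weightedSum Z e w k ω)) P := fun k =>
    (memLp_runMax hL e w k).integrable_mul
      ((memLp_weightedSum hL e w (k + 1)).sub (memLp_weightedSum hL e w k))
  have h0 : ∀ k ∈ Finset.range N, ∫ ω, runMax (fun j => weightedSum Z e w j ω) k *
      (weightedSum Z e w (k + 1) ω - weightedSum Z e w k ω) ∂P = 0 := by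
    intro k hk
    have h := integral_mul_eq_zero_of_pastSigma hm hZ hmean he (Finset.mem_range.1 hk)
      (measurable_runMax_of _ e w k fun j hj => measurable_pastSigma hj)
      (measurable_runMax_of _ e w k fun j _ => hm _)
    simp_rw [weightedSum_succ, add_sub_cancel_left, mul_left_comm _ (w k)]
    rw [integral_const_mul, h, mul_zero]
  have i1 := (memLp_weightedSum hL e w N).integrable_sq
  calc ∫ ω, runMax (fun j => weightedSum Z e w j ω) N ^ 2 ∂P
      ≤ ∫ ω, (4 * weightedSum Z e w N ω ^ 2 - 4 * ∑ k ∈ Finset.range N,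
          runMax (fun j => weightedSum Z e w j ω) k *
          (weightedSum Z e w (k + 1) ω - weightedSum Z e w k ω)) ∂P := by
        refine integral_mono (memLp_runMax hL e w N).integrable_sq
          ((i1.const_mul 4).sub ((integrable_finsetSum _ fun k _ => hi k).const_mul 4)) fun ω => ?_
        exact runMax_sq_le (fun j => weightedSum Z e w j ω) N
    _ = 4 * ∫ ω, weightedSum Z e w N ω ^ 2 ∂P := by
        rw [integral_sub (i1.const_mul 4) ((integrable_finsetSum _ fun k _ => hi k).const_mul 4),
          integral_const_mul, integral_const_mul, integral_finsetSum _ fun k _ => hi k,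
          Finset.sum_eq_zero h0, mul_zero, sub_zero]
    _ ≤ _ := by
        gcongr
        exact integral_weightedSum_sq_le hm hZ hL hmean hV he w le_rfl

/-- A maximal inequality for averages over all windows of length at least `v` that start at a
given index. -/
theorem exists_majorant_averages [IsProbabilityMeasure P] (hm : ∀ i, Measurable (Z i))
    (hZ : iIndepFun Z P) (hL : ∀ i, MemLp (Z i) 2 P) (hmean : ∀ i, ∫ ω, Z i ω ∂P = 0) {V : ℝ}
    (hV0 : 0 ≤ V) (hV : ∀ i, ∫ ω, Z i ω ^ 2 ∂P ≤ V) {e : ℕ → ι} {N : ℕ}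
    (he : Set.InjOn e (Set.Iio N)) {v : ℕ} (hv : 1 ≤ v) :
    ∃ G : Ω → ℝ, Measurable G ∧ (∀ ω, 0 ≤ G ω) ∧
      ∫⁻ ω, ENNReal.ofReal (G ω ^ 2) ∂P ≤ ENNReal.ofReal (128 * V / v) ∧
      ∀ ω l, v ≤ l → l ≤ N → |∑ j ∈ Finset.range l, Z (e j) ω| ≤ l * G ω := by
  set w : ℕ → ℝ := fun m => 1 / (max (m + 1) v : ℕ) with hw
  -- `runMax` controls only upper deviations, so the negated weights supply the lower ones. The
  -- constant is `128 = 2 * 8 * 4 * 2`: two maxima, `(2 * (A + B)) ^ 2 ≤ 8 * A ^ 2 + 8 * B ^ 2`,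
  -- Doob's factor, and the sum of squared weights.
  set A : Ω → ℝ := fun ω => runMax (fun j => weightedSum Z e w j ω) N with hA
  set B : Ω → ℝ := fun ω => runMax (fun j => weightedSum Z e (fun m => -w m) j ω) N with hB
  have hneg : ∀ j ω, weightedSum Z e (fun m => -w m) j ω = -weightedSum Z e w j ω := by
    intro j ω
    simp [weightedSum]
  have hA0 : ∀ ω, 0 ≤ A ω := fun ω => runMax_nonneg _ _
  have hB0 : ∀ ω, 0 ≤ B ω := fun ω => runMax_nonneg _ _
  have hAL : MemLp A 2 P := memLp_runMax hL e w N
  have hBL : MemLp B 2 P := memLp_runMax hL e _ N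
  have hGL : MemLp (fun ω => 2 * (A ω + B ω)) 2 P := (hAL.add hBL).const_mul 2
  have hA2 := integral_runMax_sq_le hm hZ hL hmean hV he w
  have hB2 := integral_runMax_sq_le hm hZ hL hmean hV he fun m => -w m
  simp only [neg_sq] at hB2
  have hW := mul_le_mul_of_nonneg_left (sum_weights_sq_le hv N) hV0
  refine ⟨fun ω => 2 * (A ω + B ω), ?_, fun ω => by have := hA0 ω; have := hB0 ω; positivity,
    ?_, ?_⟩
  · exact ((measurable_runMax_of _ e w N fun j _ => hm _).add
      (measurable_runMax_of _ e _ N fun j _ => hm _)).const_mul 2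
  · rw [← ofReal_integral_eq_lintegral_ofReal hGL.integrable_sq
      (Filter.Eventually.of_forall fun ω => sq_nonneg _)]
    refine ENNReal.ofReal_le_ofReal ?_
    calc ∫ ω, (2 * (A ω + B ω)) ^ 2 ∂P ≤ ∫ ω, (8 * A ω ^ 2 + 8 * B ω ^ 2) ∂P := by
          refine integral_mono hGL.integrable_sq
            ((hAL.integrable_sq.const_mul 8).add (hBL.integrable_sq.const_mul 8)) fun ω => ?_
          dsimp only
          nlinarith [sq_nonneg (A ω - B ω)]
      _ = 8 * ∫ ω, A ω ^ 2 ∂P + 8 * ∫ ω, B ω ^ 2 ∂P := by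
          rw [integral_add (hAL.integrable_sq.const_mul 8) (hBL.integrable_sq.const_mul 8),
            integral_const_mul, integral_const_mul]
      _ ≤ 64 * (V * (2 / v)) := by linarith
      _ = _ := by ring
  · intro ω l hvl hlN
    refine abs_sum_le_of_weighted (fun j => Z (e j) ω) hv hvl fun j hj => ?_
    have h1 : weightedSum Z e w j ω ≤ A ω :=
      le_runMax (T := fun j => weightedSum Z e w j ω) (by simp [weightedSum]) (hj.trans hlN)
    have h2 : -weightedSum Z e w j ω ≤ B ω := by
      rw [← hneg]
      exact le_runMax (T := fun j => weightedSum Z e (fun m => -w m) j ω) (by simp [weightedSum])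
        (hj.trans hlN)
    have h3 := hA0 ω
    have h4 := hB0 ω
    exact abs_le.2 ⟨by change _ ≤ weightedSum Z e w j ω; linarith,
      by change weightedSum Z e w j ω ≤ _; linarith⟩

end Noise


/-! ### The error at a single coordinate. -/

theorem sum_Icc_eq_sum_range_left {n : ℕ} (z : Fin n → ℝ) {s b : Fin n} (h : s ≤ b) :
    ∑ j ∈ Finset.Icc s b, z j =
      ∑ l ∈ Finset.range ((b : ℕ) + 1 - s), z ⟨b - l, (Nat.sub_le _ _).trans_lt b.2⟩ := by
  have h' : (s : ℕ) ≤ b := h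
  refine Finset.sum_nbij' (fun j => (b : ℕ) - j)
    (fun l => ⟨b - l, (Nat.sub_le _ _).trans_lt b.2⟩) ?_ ?_ ?_ ?_ ?_
  · intro j hj
    have h1 : (s : ℕ) ≤ j := (Finset.mem_Icc.1 hj).1
    have h2 : (j : ℕ) ≤ b := (Finset.mem_Icc.1 hj).2
    exact Finset.mem_range.2 (by omega)
  · intro l hl
    have := Finset.mem_range.1 hl
    refine Finset.mem_Icc.2 ⟨Fin.le_def.2 ?_, Fin.le_def.2 ?_⟩ <;> dsimp only <;> omega
  · intro j hj
    have h2 : (j : ℕ) ≤ b := (Finset.mem_Icc.1 hj).2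
    exact Fin.ext (by dsimp only; omega)
  · intro l hl
    have := Finset.mem_range.1 hl
    dsimp only
    omega
  · intro j hj
    have h2 : (j : ℕ) ≤ b := (Finset.mem_Icc.1 hj).2
    congr 1
    exact Fin.ext (by dsimp only; omega)

/-- The minimum with `n - 1` only makes the index total in `l`; it is never active in the range
summed. -/
theorem sum_Icc_eq_sum_range_right {n : ℕ} (z : Fin n → ℝ) {a s : Fin n} (h : a ≤ s) :
    ∑ j ∈ Finset.Icc a s, z j =
      ∑ l ∈ Finset.range ((s : ℕ) + 1 - a),
        z ⟨min (a + l) (n - 1), by have := a.2; omega⟩ := by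
  have h' : (a : ℕ) ≤ s := h
  have hs := s.2
  refine Finset.sum_nbij' (fun j => (j : ℕ) - a)
    (fun l => ⟨min (a + l) (n - 1), by have := a.2; omega⟩) ?_ ?_ ?_ ?_ ?_
  · intro j hj
    have h1 : (a : ℕ) ≤ j := (Finset.mem_Icc.1 hj).1
    have h2 : (j : ℕ) ≤ s := (Finset.mem_Icc.1 hj).2
    exact Finset.mem_range.2 (by omega)
  · intro l hl
    have := Finset.mem_range.1 hl
    refine Finset.mem_Icc.2 ⟨Fin.le_def.2 ?_, Fin.le_def.2 ?_⟩ <;> dsimp only <;> omega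
  · intro j hj
    have h2 : (a : ℕ) ≤ j := (Finset.mem_Icc.1 hj).1
    exact Fin.ext (by dsimp only; omega)
  · intro l hl
    have := Finset.mem_range.1 hl
    dsimp only
    omega
  · intro j hj
    have h2 : (a : ℕ) ≤ j := (Finset.mem_Icc.1 hj).1
    congr 1
    exact Fin.ext (by dsimp only; omega)

/-- Truncation at level `B`: above it, `G ^ (p - 2) ≤ B ^ (p - 2)`. This passes from second to
`p`-th moments. -/
theorem rpow_le_add_sq {p B G : ℝ} (hp : 0 ≤ p) (hp2 : p ≤ 2) (hB : 0 < B) (hG : 0 ≤ G) :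
    G ^ p ≤ B ^ p + B ^ (p - 2) * G ^ 2 := by
  rcases le_total G B with h | h
  · have := Real.rpow_le_rpow hG h hp
    have : 0 ≤ B ^ (p - 2) * G ^ 2 := by positivity
    linarith
  · have hG' : 0 < G := hB.trans_le h
    have e : G ^ p = G ^ (p - 2) * G ^ 2 := by
      rw [← Real.rpow_natCast, ← Real.rpow_add hG']
      norm_num
    rw [e]
    have h1 : G ^ (p - 2) ≤ B ^ (p - 2) := Real.rpow_le_rpow_of_nonpos hB h (by linarith)
    have : 0 ≤ B ^ p := by positivity
    nlinarith [sq_nonneg G]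

theorem lintegral_rpow_le {Ω : Type*} [MeasurableSpace Ω] {P : Measure Ω} [IsProbabilityMeasure P]
    {p C σ : ℝ} (hp : 0 ≤ p) (hp2 : p ≤ 2) (hC : 0 ≤ C) (hσ : 0 < σ) {v : ℕ} (hv : 1 ≤ v)
    {G : Ω → ℝ} (hG : Measurable G) (hG0 : ∀ ω, 0 ≤ G ω)
    (h : ∫⁻ ω, ENNReal.ofReal (G ω ^ 2) ∂P ≤ ENNReal.ofReal (C * σ ^ 2 / v)) :
    ∫⁻ ω, ENNReal.ofReal (G ω ^ p) ∂P ≤ ENNReal.ofReal ((1 + C) * σ ^ p * (v : ℝ) ^ (-(p / 2))) := by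
  have hv' : (0 : ℝ) < v := by exact_mod_cast hv
  -- The root-mean-square scale of `G`, at which both terms of the truncation are of order `B ^ p`.
  set B : ℝ := σ * (v : ℝ) ^ (-(1 / 2) : ℝ) with hB
  have hB0 : 0 < B := by positivity
  have hBp : B ^ p = σ ^ p * (v : ℝ) ^ (-(p / 2)) := by
    rw [hB, Real.mul_rpow hσ.le (by positivity), ← Real.rpow_mul hv'.le]
    congr 2
    ring
  have hB2 : B ^ 2 = σ ^ 2 / v := by
    rw [hB, mul_pow, ← Real.rpow_natCast ((v : ℝ) ^ _), ← Real.rpow_mul hv'.le]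
    norm_num
    rw [Real.rpow_neg_one, div_eq_mul_inv]
  have hBB : B ^ (p - 2) * B ^ 2 = B ^ p := by
    rw [← Real.rpow_natCast B 2, ← Real.rpow_add hB0]
    norm_num
  calc ∫⁻ ω, ENNReal.ofReal (G ω ^ p) ∂P
      ≤ ∫⁻ ω, (ENNReal.ofReal (B ^ p) +
          ENNReal.ofReal (B ^ (p - 2)) * ENNReal.ofReal (G ω ^ 2)) ∂P := by
        refine lintegral_mono fun ω => ?_
        rw [← ENNReal.ofReal_mul (by positivity), ← ENNReal.ofReal_add (by positivity)
          (by positivity)]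
        exact ENNReal.ofReal_le_ofReal (rpow_le_add_sq hp hp2 hB0 (hG0 ω))
    _ = ENNReal.ofReal (B ^ p) +
          ENNReal.ofReal (B ^ (p - 2)) * ∫⁻ ω, ENNReal.ofReal (G ω ^ 2) ∂P := by
        rw [lintegral_add_left measurable_const, lintegral_const_mul _ (by fun_prop)]
        simp
    _ ≤ ENNReal.ofReal (B ^ p) +
          ENNReal.ofReal (B ^ (p - 2)) * ENNReal.ofReal (C * σ ^ 2 / v) := by gcongr
    _ = ENNReal.ofReal ((1 + C) * σ ^ p * (v : ℝ) ^ (-(p / 2))) := by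
        rw [← ENNReal.ofReal_mul (by positivity), ← ENNReal.ofReal_add (by positivity)
          (by positivity)]
        congr 1
        rw [mul_assoc (1 + C), ← hBp, mul_div_assoc, ← hB2, mul_left_comm, hBB]
        ring

/-- A measurable majorant for the error of isotonic regression at a single coordinate that lies in
a constant piece `[a, b]` of the signal. -/
theorem exists_majorant_error {n : ℕ} {Ω : Type*} [MeasurableSpace Ω] {P : Measure Ω}
    [IsProbabilityMeasure P] {Z : Fin n → Ω → ℝ} (hm : ∀ i, Measurable (Z i))
    (hZ : iIndepFun Z P) (hL : ∀ i, MemLp (Z i) 2 P) (hmean : ∀ i, ∫ ω, Z i ω ∂P = 0)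
    {C₁ σ p : ℝ} (hC : 0 ≤ C₁) (hσ : 0 < σ) (hp : 0 ≤ p) (hp2 : p ≤ 2)
    (hV : ∀ i, ∫ ω, Z i ω ^ 2 ∂P ≤ C₁ * σ ^ 2) {θ : Fin n → ℝ} (hθ : Monotone θ) {a i b : Fin n}
    (hai : a ≤ i) (hib : i ≤ b) (ha : θ a = θ i) (hb : θ b = θ i) :
    ∃ H : Ω → ℝ≥0∞, Measurable H ∧
      (∀ ω, ENNReal.ofReal (|isotonicRegression (fun j => θ j + Z j ω) i - θ i| ^ p) ≤ H ω) ∧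
      ∫⁻ ω, H ω ∂P ≤ ENNReal.ofReal ((1 + 128 * C₁) * σ ^ p *
        ((((i : ℕ) + 1 - a : ℕ) : ℝ) ^ (-(p / 2)) + (((b : ℕ) + 1 - i : ℕ) : ℝ) ^ (-(p / 2)))) := by
  have hai' : (a : ℕ) ≤ i := hai
  have hib' : (i : ℕ) ≤ b := hib
  have hV0 : 0 ≤ C₁ * σ ^ 2 := by positivity
  -- `G` handles windows read leftwards from `b`, and `G'` below those read rightwards from `a`.
  -- Windows that reach `i` have length at least `b + 1 - i`, respectively `i + 1 - a`.
  obtain ⟨G, hG, hG0, hG2, hGs⟩ := exists_majorant_averages hm hZ hL hmean hV0 hV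
    (e := fun l => ⟨b - l, (Nat.sub_le _ _).trans_lt b.2⟩) (N := (b : ℕ) + 1)
    (v := (b : ℕ) + 1 - i) (by
      intro l hl l' hl' h
      have h1 : l < (b : ℕ) + 1 := hl
      have h2 : l' < (b : ℕ) + 1 := hl'
      have h3 := Fin.ext_iff.1 h
      dsimp only at h3
      omega) (by omega)
  obtain ⟨G', hG', hG0', hG2', hGs'⟩ := exists_majorant_averages hm hZ hL hmean hV0 hV
    (e := fun l => ⟨min (a + l) (n - 1), by have := a.2; omega⟩) (N := n - a)
    (v := (i : ℕ) + 1 - a) (by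
      intro l hl l' hl' h
      have h1 : l < n - a := hl
      have h2 : l' < n - a := hl'
      have h3 := Fin.ext_iff.1 h
      dsimp only at h3
      omega) (by omega)
  refine ⟨fun ω => ENNReal.ofReal (G' ω ^ p) + ENNReal.ofReal (G ω ^ p), by fun_prop, ?_, ?_⟩
  · intro ω
    dsimp only
    rw [← ENNReal.ofReal_add (Real.rpow_nonneg (hG0' ω) _) (Real.rpow_nonneg (hG0 ω) _)]
    refine ENNReal.ofReal_le_ofReal ?_
    set D := isotonicRegression (fun j => θ j + Z j ω) i - θ i with hD
    have hp1 := Real.rpow_nonneg (hG0 ω) p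
    have hp1' := Real.rpow_nonneg (hG0' ω) p
    rcases le_total 0 D with h | h
    · obtain ⟨s, hs, h1⟩ := exists_card_mul_error_le hθ (fun j => Z j ω) hb
      have hs' : (s : ℕ) ≤ i := hs
      rw [sum_Icc_eq_sum_range_left _ (hs.trans hib)] at h1
      have h2 := (le_abs_self _).trans (hGs ω ((b : ℕ) + 1 - s) (by omega) (by omega))
      have h3 : (0 : ℝ) < ((b : ℕ) + 1 - s : ℕ) := by
        have : 0 < (b : ℕ) + 1 - s := by omega
        exact_mod_cast this
      have h4 : D ≤ G ω := le_of_mul_le_mul_left (h1.trans h2) h3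
      rw [abs_of_nonneg h]
      have := Real.rpow_le_rpow h h4 hp
      linarith
    · obtain ⟨s, hs, h1⟩ := exists_le_card_mul_error hθ (fun j => Z j ω) ha
      have hs' : (i : ℕ) ≤ s := hs
      have hsn := s.2
      rw [sum_Icc_eq_sum_range_right _ (hai.trans hs)] at h1
      have h2 := (neg_abs_le _).trans h1
      have h2' := hGs' ω ((s : ℕ) + 1 - a) (by omega) (by omega)
      have h3 : (0 : ℝ) < ((s : ℕ) + 1 - a : ℕ) := by
        have : 0 < (s : ℕ) + 1 - a := by omega
        exact_mod_cast this
      have h4 : -D ≤ G' ω := le_of_mul_le_mul_left (by linarith) h3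
      rw [abs_of_nonpos h]
      have := Real.rpow_le_rpow (by linarith) h4 hp
      linarith
  · rw [lintegral_add_left (by fun_prop), mul_add, ENNReal.ofReal_add (by positivity) (by positivity)]
    rw [← mul_assoc] at hG2 hG2'
    exact add_le_add
      (lintegral_rpow_le hp hp2 (by positivity) hσ (by omega) hG' hG0' hG2')
      (lintegral_rpow_le hp hp2 (by positivity) hσ (by omega) hG hG0 hG2)

/-! ### Summation over coordinates and pieces. -/

/-- Bernoulli's inequality for the concave power `1 - q` bounds each term by an increment of `m ^ (1
- q) / (1 - q)`. With `q = p / 2`, this is where `p < 2` is essential. -/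
theorem sum_range_rpow_neg_le {q : ℝ} (hq : 0 ≤ q) (hq1 : q < 1) (m : ℕ) :
    ∑ l ∈ Finset.range m, ((l + 1 : ℕ) : ℝ) ^ (-q) ≤ (m : ℝ) ^ (1 - q) / (1 - q) := by
  have hα : 0 < 1 - q := by linarith
  rw [le_div_iff₀ hα]
  induction m with
  | zero => simp [Real.zero_rpow hα.ne']
  | succ m ih =>
    rw [Finset.sum_range_succ, add_mul]
    have hm : (0 : ℝ) < ((m + 1 : ℕ) : ℝ) := by positivity
    have h1 := rpow_one_add_le_one_add_mul_self (s := -(1 / ((m + 1 : ℕ) : ℝ)))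
      (by rw [neg_le_neg_iff, div_le_one hm]; exact_mod_cast Nat.succ_le_succ (Nat.zero_le m))
      hα.le (by linarith : 1 - q ≤ 1)
    have e1 : 1 + -(1 / ((m + 1 : ℕ) : ℝ)) = m / ((m + 1 : ℕ) : ℝ) := by
      field_simp
      push_cast
      ring
    rw [e1, Real.div_rpow (Nat.cast_nonneg _) hm.le, div_le_iff₀ (by positivity)] at h1
    have e2 : ((m + 1 : ℕ) : ℝ) ^ (-q) = ((m + 1 : ℕ) : ℝ) ^ (1 - q) / ((m + 1 : ℕ) : ℝ) := by
      rw [← Real.rpow_sub_one hm.ne']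
      congr 1
      ring
    rw [e2]
    have e3 : (1 + (1 - q) * -(1 / ((m + 1 : ℕ) : ℝ))) * ((m + 1 : ℕ) : ℝ) ^ (1 - q) =
        ((m + 1 : ℕ) : ℝ) ^ (1 - q) -
          ((m + 1 : ℕ) : ℝ) ^ (1 - q) / ((m + 1 : ℕ) : ℝ) * (1 - q) := by
      field_simp
      ring
    linarith

theorem sum_Ico_rpow_le {q : ℝ} (hq : 0 ≤ q) (hq1 : q < 1) (a b : ℕ) :
    ∑ i ∈ Finset.Ico a b, (((i + 1 - a : ℕ) : ℝ) ^ (-q) + ((b - i : ℕ) : ℝ) ^ (-q)) ≤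
      2 / (1 - q) * ((b - a : ℕ) : ℝ) ^ (1 - q) := by
  rw [Finset.sum_add_distrib, Finset.sum_Ico_eq_sum_range, Finset.sum_Ico_eq_sum_range]
  have h1 : ∑ l ∈ Finset.range (b - a), ((a + l + 1 - a : ℕ) : ℝ) ^ (-q) =
      ∑ l ∈ Finset.range (b - a), ((l + 1 : ℕ) : ℝ) ^ (-q) :=
    Finset.sum_congr rfl fun l _ => by congr 2; omega
  have h2 : ∑ l ∈ Finset.range (b - a), ((b - (a + l) : ℕ) : ℝ) ^ (-q) =
      ∑ l ∈ Finset.range (b - a), ((l + 1 : ℕ) : ℝ) ^ (-q) := by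
    rw [← Finset.sum_range_reflect]
    refine Finset.sum_congr rfl fun l hl => ?_
    have := Finset.mem_range.1 hl
    congr 2
    omega
  rw [h1, h2]
  have := sum_range_rpow_neg_le hq hq1 (b - a)
  calc _ ≤ ((b - a : ℕ) : ℝ) ^ (1 - q) / (1 - q) + ((b - a : ℕ) : ℝ) ^ (1 - q) / (1 - q) :=
        add_le_add this this
    _ = _ := by ring

/-- Jensen's inequality, through the tangent line of `x ^ α` at the mean `n / k`. -/
theorem sum_rpow_le_of_sum_eq {k : ℕ} (hk : 1 ≤ k) {α n : ℝ} (hα : 0 ≤ α) (hα1 : α ≤ 1)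
    (hn : 0 < n) (m : Fin k → ℝ) (hm : ∀ j, 0 ≤ m j) (hs : ∑ j, m j = n) :
    ∑ j, m j ^ α ≤ k * (n / k) ^ α := by
  have hk' : (0 : ℝ) < k := by exact_mod_cast hk
  set t := n / k with ht
  have ht0 : 0 < t := by positivity
  have h1 : ∀ j, m j ^ α ≤ (1 + α * (m j / t - 1)) * t ^ α := by
    intro j
    have h := rpow_one_add_le_one_add_mul_self (s := m j / t - 1)
      (by have : 0 ≤ m j / t := div_nonneg (hm j) ht0.le
          linarith) hα hα1
    rwa [add_sub_cancel, Real.div_rpow (hm j) ht0.le, div_le_iff₀ (by positivity)] at h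
  refine (Finset.sum_le_sum fun j _ => h1 j).trans (le_of_eq ?_)
  rw [← Finset.sum_mul, Finset.sum_add_distrib, ← Finset.mul_sum, Finset.sum_sub_distrib,
    ← Finset.sum_div, hs]
  have : n / t = k := by rw [ht]; field_simp
  simp [this]

theorem sum_Ico_eq_sum_blocks {M : Type*} [AddCommMonoid M] (g : ℕ → M) {k : ℕ}
    (a : Fin (k + 1) → ℕ) (ha : Monotone a) :
    ∑ i ∈ Finset.Ico (a 0) (a (Fin.last k)), g i =
      ∑ j : Fin k, ∑ i ∈ Finset.Ico (a j.castSucc) (a j.succ), g i := by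
  induction k with
  | zero => simp
  | succ k ih =>
    rw [Fin.sum_univ_castSucc]
    have h := ih (fun j => a j.castSucc) fun i j hij => ha (Fin.castSucc_le_castSucc_iff.2 hij)
    simp only [Fin.castSucc_zero] at h
    rw [← Finset.sum_Ico_consecutive g (ha (Fin.zero_le (Fin.last k).castSucc))
      (ha (Fin.le_last (Fin.last k).castSucc)), h]
    rfl


theorem exists_block {n k : ℕ} {a : Fin (k + 1) → ℕ} (h0 : a 0 = 0) (hn : a (Fin.last k) = n)
    {i : ℕ} (hi : i < n) : ∃ j : Fin k, a j.castSucc ≤ i ∧ i < a j.succ := by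
  by_contra hcon
  push Not at hcon
  have : ∀ j : Fin (k + 1), a j ≤ i := by
    intro j
    induction j using Fin.induction with
    | zero => omega
    | succ j ih => exact hcon j ih
  have := this (Fin.last k)
  omega

theorem le_of_block {k : ℕ} {a : Fin (k + 1) → ℕ} (ha : Monotone a) {i i' : ℕ} (hi : i ≤ i')
    {j j' : Fin k} (h : a j.castSucc ≤ i) (h' : i' < a j'.succ) : j ≤ j' := by
  by_contra hcon
  have : a j'.succ ≤ a j.castSucc := ha (by
    rw [Fin.le_def]
    simpa using hcon)
  omega

theorem monotone_of_mem_monoPieces {n k : ℕ} {θ : Fin n → ℝ} (hθ : θ ∈ monoPieces n k) :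
    Monotone θ := by
  obtain ⟨a, μ, h0, hn, ha, hμ, h⟩ := hθ
  intro i i' hii
  obtain ⟨j, h1, h2⟩ := exists_block h0 hn i.2
  obtain ⟨j', h1', h2'⟩ := exists_block h0 hn i'.2
  rw [h j i (by omega) h2, h j' i' (by omega) h2']
  exact hμ (le_of_block ha hii h1 h2')

/-- The risk bound for isotonic regression over vectors with `k` monotone pieces. -/
theorem isotonicRegression_risk_le {n k : ℕ} (hk : 1 ≤ k) (hkn : k ≤ n) {Ω : Type*}
    [MeasurableSpace Ω] {P : Measure Ω}
    [IsProbabilityMeasure P] {Z : Fin n → Ω → ℝ} (hm : ∀ i, Measurable (Z i))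
    (hZ : iIndepFun Z P) (hL : ∀ i, MemLp (Z i) 2 P) (hmean : ∀ i, ∫ ω, Z i ω ∂P = 0)
    {C₁ σ p : ℝ} (hC : 0 ≤ C₁) (hσ : 0 < σ) (hp : 0 < p) (hp2 : p < 2)
    (hV : ∀ i, ∫ ω, Z i ω ^ 2 ∂P ≤ C₁ * σ ^ 2) {θ : Fin n → ℝ} (hθ : θ ∈ monoPieces n k) :
    ∫⁻ ω, ENNReal.ofReal (lpNorm p (isotonicRegression (fun i => θ i + Z i ω) - θ) ^ p) ∂P ≤
      ENNReal.ofReal ((1 + 128 * C₁) * (2 / (1 - p / 2)) * σ ^ p * n * ((k : ℝ) / n) ^ (p / 2)) := by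
  have hk' : (0 : ℝ) < k := by exact_mod_cast hk
  have hn' : (0 : ℝ) < n := by exact_mod_cast hk.trans hkn
  have hmono := monotone_of_mem_monoPieces hθ
  obtain ⟨a, μ, h0, hn, ha, hμ, h⟩ := hθ
  set K : ℝ := (1 + 128 * C₁) * σ ^ p with hK
  have hK0 : 0 ≤ K := by positivity
  have hq : 0 < 1 - p / 2 := by linarith
  -- Measurable majorants allow the integral and the sum over coordinates to be exchanged without
  -- measurability of the estimator.
  have hmaj : ∀ i : Fin n, ∃ H : Ω → ℝ≥0∞, Measurable H ∧
      (∀ ω, ENNReal.ofReal (|isotonicRegression (fun j => θ j + Z j ω) i - θ i| ^ p) ≤ H ω) ∧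
      ∀ j : Fin k, a j.castSucc ≤ i → (i : ℕ) < a j.succ →
        ∫⁻ ω, H ω ∂P ≤ ENNReal.ofReal (K * ((((i : ℕ) + 1 - a j.castSucc : ℕ) : ℝ) ^ (-(p / 2)) +
          ((a j.succ - i : ℕ) : ℝ) ^ (-(p / 2)))) := by
    intro i
    obtain ⟨j, h1, h2⟩ := exists_block h0 hn i.2
    have h3 : a j.succ ≤ n := hn ▸ ha (Fin.le_last _)
    have hi := h j i (by omega) h2
    obtain ⟨H, hH1, hH2, hH3⟩ := exists_majorant_error hm hZ hL hmean hC hσ hp.le hp2.le hV hmono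
      (a := ⟨a j.castSucc, h1.trans_lt i.2⟩) (i := i) (b := ⟨a j.succ - 1, by omega⟩)
      (Fin.le_def.2 h1) (Fin.le_def.2 (by dsimp only; omega))
      ((h j _ (by dsimp only; omega) (by dsimp only; omega)).trans hi.symm)
      ((h j _ (by dsimp only; omega) (by dsimp only; omega)).trans hi.symm)
    refine ⟨H, hH1, hH2, fun j' h1' h2' => ?_⟩
    -- Pieces may be empty, but the one containing `i` is unique.
    obtain rfl : j = j' := le_antisymm (le_of_block ha le_rfl h1 h2') (le_of_block ha le_rfl h1' h2)
    convert hH3 using 7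
    dsimp only
    omega
  choose H hH1 hH2 hH3 using hmaj
  set g : ℕ → ℝ≥0∞ := fun i => if hi : i < n then ∫⁻ ω, H ⟨i, hi⟩ ω ∂P else 0 with hg
  have hblock : ∀ j : Fin k, ∑ i ∈ Finset.Ico (a j.castSucc) (a j.succ), g i ≤
      ENNReal.ofReal (K * (2 / (1 - p / 2) *
        ((a j.succ - a j.castSucc : ℕ) : ℝ) ^ (1 - p / 2))) := by
    intro j
    have h3 : a j.succ ≤ n := hn ▸ ha (Fin.le_last _)
    calc ∑ i ∈ Finset.Ico (a j.castSucc) (a j.succ), g i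
        ≤ ∑ i ∈ Finset.Ico (a j.castSucc) (a j.succ), ENNReal.ofReal
            (K * (((i + 1 - a j.castSucc : ℕ) : ℝ) ^ (-(p / 2)) +
              ((a j.succ - i : ℕ) : ℝ) ^ (-(p / 2)))) := by
          refine Finset.sum_le_sum fun i hi => ?_
          have hi' := Finset.mem_Ico.1 hi
          simp only [hg, dif_pos (hi'.2.trans_le h3)]
          exact hH3 ⟨i, hi'.2.trans_le h3⟩ j hi'.1 hi'.2
      _ = ENNReal.ofReal (K * ∑ i ∈ Finset.Ico (a j.castSucc) (a j.succ),
            (((i + 1 - a j.castSucc : ℕ) : ℝ) ^ (-(p / 2)) +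
              ((a j.succ - i : ℕ) : ℝ) ^ (-(p / 2)))) := by
          rw [← ENNReal.ofReal_sum_of_nonneg fun i _ => by positivity, Finset.mul_sum]
      _ ≤ _ := ENNReal.ofReal_le_ofReal (mul_le_mul_of_nonneg_left
            (sum_Ico_rpow_le (by positivity) (by linarith) _ _) hK0)
  have hlen : ∑ j : Fin k, ((a j.succ - a j.castSucc : ℕ) : ℝ) = n := by
    have := sum_Ico_eq_sum_blocks (fun _ => 1) a ha
    simp only [Finset.sum_const, Nat.card_Ico, smul_eq_mul, mul_one, h0, hn, Nat.sub_zero] at this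
    exact_mod_cast this.symm
  calc ∫⁻ ω, ENNReal.ofReal (lpNorm p (isotonicRegression (fun i => θ i + Z i ω) - θ) ^ p) ∂P
      ≤ ∫⁻ ω, ∑ i, H i ω ∂P := by
        refine lintegral_mono fun ω => ?_
        rw [ofReal_lpNorm_rpow hp]
        exact Finset.sum_le_sum fun i _ => hH2 i ω
    _ = ∑ i, ∫⁻ ω, H i ω ∂P := lintegral_finsetSum _ fun i _ => hH1 i
    _ = ∑ i ∈ Finset.Ico (a 0) (a (Fin.last k)), g i := by
        rw [h0, hn, ← Finset.range_eq_Ico, Finset.sum_range]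
        exact Finset.sum_congr rfl fun i _ => by simp [hg]
    _ = ∑ j : Fin k, ∑ i ∈ Finset.Ico (a j.castSucc) (a j.succ), g i := sum_Ico_eq_sum_blocks g a ha
    _ ≤ ∑ j : Fin k, ENNReal.ofReal (K * (2 / (1 - p / 2) *
        ((a j.succ - a j.castSucc : ℕ) : ℝ) ^ (1 - p / 2))) := Finset.sum_le_sum fun j _ => hblock j
    _ = ENNReal.ofReal (K * (2 / (1 - p / 2)) *
          ∑ j : Fin k, ((a j.succ - a j.castSucc : ℕ) : ℝ) ^ (1 - p / 2)) := by
        rw [← ENNReal.ofReal_sum_of_nonneg fun i _ => by positivity, Finset.mul_sum]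
        simp only [mul_assoc]
    _ ≤ ENNReal.ofReal (K * (2 / (1 - p / 2)) * (k * ((n : ℝ) / k) ^ (1 - p / 2))) := by
        refine ENNReal.ofReal_le_ofReal (mul_le_mul_of_nonneg_left ?_ (by positivity))
        exact sum_rpow_le_of_sum_eq hk hq.le (by linarith) hn' _ (fun _ => Nat.cast_nonneg _) hlen
    _ = _ := by
        have e : (k : ℝ) * ((n : ℝ) / k) ^ (1 - p / 2) = n * ((k : ℝ) / n) ^ (p / 2) := by
          rw [sub_eq_add_neg, Real.rpow_add (by positivity), Real.rpow_one,
            Real.rpow_neg (by positivity), ← Real.inv_rpow (by positivity), inv_div]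
          field_simp
        rw [e, hK]
        congr 1
        ring

end IsoReg

theorem proposition4p3 :
    -- upper bound for isotonic regression, under errors with bounded second moments
    (∀ C₁ : ℝ, 0 < C₁ → ∀ p : ℝ, 1 ≤ p → p < 2 → ∃ C : ℝ, 0 < C ∧
      ∀ (n k : ℕ), 1 ≤ k → k ≤ n → ∀ σ : ℝ, 0 < σ →
      ∀ (Ω : Type*) [MeasurableSpace Ω] (P : Measure Ω) [IsProbabilityMeasure P]
        (Z : Fin n → Ω → ℝ),
        (∀ i, Measurable (Z i)) → iIndepFun Z P →
        (∀ i, MemLp (Z i) 2 P) → (∀ i, ∫ ω, Z i ω ∂P = 0) →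
        (∀ i, ∫ ω, |Z i ω / σ| ^ 2 ∂P ≤ C₁) →
        (⨆ θ ∈ IsoReg.monoPieces n k,
          ∫⁻ ω, ENNReal.ofReal
            (IsoReg.lpNorm p (IsoReg.isotonicRegression (fun i => θ i + Z i ω) - θ) ^ p) ∂P)
          ≤ ENNReal.ofReal (C * σ ^ p * n * ((k : ℝ) / n) ^ (p / 2))) ∧
    -- minimax lower bound for Gaussian observations
    (∃ c : ℝ, 0 < c ∧
      ∀ p : ℝ, 1 ≤ p → p < 2 → ∀ (n k : ℕ), 1 ≤ k → k ≤ n → ∀ σ : ℝ, 0 < σ →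
        ENNReal.ofReal (c * σ ^ p * n * ((k : ℝ) / n) ^ (p / 2)) ≤
          ⨅ (est : (Fin n → ℝ) → (Fin n → ℝ)) (_ : Measurable est),
            ⨆ θ ∈ IsoReg.monoPieces n k,
              ∫⁻ x, ENNReal.ofReal (IsoReg.lpNorm p (est x - θ) ^ p)
                ∂(IsoReg.gaussianVec θ σ)) := by 
  refine ⟨fun C₁ hC₁ p hp hp2 => ?_, 1 / 64, by norm_num, fun p hp hp2 n k hk hkn σ hσ => ?_⟩
  · have hq : 0 < 1 - p / 2 := by linarith
    refine ⟨(1 + 128 * C₁) * (2 / (1 - p / 2)), by positivity, ?_⟩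
    intro n k hk hkn σ hσ Ω _ P _ Z hm hZ hL hmean hV
    refine iSup₂_le fun θ hθ => IsoReg.isotonicRegression_risk_le hk hkn hm hZ hL hmean hC₁.le hσ
      (by linarith) hp2 (fun i => ?_) hθ
    have h := hV i
    simp_rw [sq_abs, div_pow] at h
    rwa [integral_div, div_le_iff₀ (by positivity)] at h
  · exact le_iInf₂ fun est hest => IsoReg.minimax_lower_bound hp hp2 hk hkn hσ est hest
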